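/- For $|q|<1$, $q\neq 0$, write $q=e^{2\pi i\tau}$ with $\operatorname{Im}\tau>0$, let $\eta(\tau)=q^{1/24}\prod_{j\ge 1}(1-q^{j})$ (with $q^{1/24}=e^{2\pi i\tau/24}$) be the Dedekind eta function, and put $\eta_\ell=\eta(\ell\tau)$. Define $$u=\left(\frac{\eta_1\eta_{20}}{\eta_4\eta_5}\right)^{2},\qquad z=\eta_2^2\,\eta_{10}^2,\qquad Z=\Bigl(\sum_{m=-\infty}^{\infty}\sum_{n=-\infty}^{\infty}q^{m^2+5n^2}\Bigr)^{2},\qquad X=\frac{z}{Z},$$ regarded as functions of $q$. Theorem. On the punctured disc $0<|q|<1$ the functions $u$ and $X$ are differentiable and have no zeros, and $$q\frac{d}{dq}\log u=\frac{z}{u}\sqrt{1-8u-2u^{2}-8u^{3}+u^{4}},\qquad q\frac{d}{dq}\log X=Z\sqrt{(1-4X)(1-12X+16X^{2})}.$$ Here $q\frac{d}{dq}\log f$ means $q f'(q)/f(q)$, and each square root denotes the analytic branch, as a function of $q$ in the unit disc $|q|<1$, that takes the value $1$ at $q=0$; in both cases such a branch exists. -/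

import Mathlib

noncomputable section

namespace LevelTwenty

open Complex

/-- The dilate `η_ℓ(τ) = η(ℓτ)` of the Dedekind eta function. -/
def etaDil (l : ℕ) (τ : ℂ) : ℂ := ModularForm.eta ((l : ℂ) * τ)

/-- `(η₁ η₂₀ / (η₄ η₅))²` as a function of `τ` in the upper half-plane. -/
def uTau (τ : ℂ) : ℂ :=
  ((etaDil 1 τ * etaDil 20 τ) / (etaDil 4 τ * etaDil 5 τ)) ^ 2

/-- `η₂² η₁₀²` as a function of `τ` in the upper half-plane. -/
def zTau (τ : ℂ) : ℂ := etaDil 2 τ ^ 2 * etaDil 10 τ ^ 2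

/-- `u` as a function of `q`, where `q = exp (2πiτ)`, `0 < |q| < 1`; see `u_qParam`. -/
def u : ℂ → ℂ := Function.Periodic.cuspFunction 1 uTau

/-- `z` as a function of `q`, where `q = exp (2πiτ)`, `0 < |q| < 1`; see `z_qParam`. -/
def z : ℂ → ℂ := Function.Periodic.cuspFunction 1 zTau

/-- `Z = (∑ₘ ∑ₙ q^(m² + 5n²))²`, the sums being over all integers. -/
def Z (q : ℂ) : ℂ := (∑' m : ℤ, ∑' n : ℤ, q ^ (m ^ 2 + 5 * n ^ 2)) ^ 2

/-- `X = z / Z`. -/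
def X (q : ℂ) : ℂ := z q / Z q

/-- `S` is the single-valued analytic branch of `√f` on the unit disc, as a function of `q`,
that takes the value `1` at `q = 0`. The value of `f` at `q = 0` itself is not used. -/
structure IsSqrtBranch (f S : ℂ → ℂ) : Prop where
  differentiableOn : DifferentiableOn ℂ S (Metric.ball 0 1)
  map_zero : S 0 = 1
  sq_eq : ∀ q : ℂ, 0 < ‖q‖ → ‖q‖ < 1 → S q ^ 2 = f q

theorem eta_add_nat (l : ℕ) (w : ℂ) :
    ModularForm.eta (w + l) = exp (2 * Real.pi * I / 24) ^ l * ModularForm.eta w := by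
  have h (n : ℕ) : ModularForm.eta_q n (w + l) = ModularForm.eta_q n w := by
    have hp : Function.Periodic (Function.Periodic.qParam 1) (1 : ℂ) := by
      intro t
      simp only [Function.Periodic.qParam, Complex.ofReal_one, div_one, mul_add, mul_one]
      rw [Complex.exp_add, Complex.exp_two_pi_mul_I, mul_one]
    have := hp.nat_mul l w
    simp only [mul_one] at this
    simp only [ModularForm.eta_q, this]
  unfold ModularForm.eta
  simp only [h]
  rw [← mul_assoc]
  congr 1
  simp only [Function.Periodic.qParam]
  rw [← Complex.exp_nat_mul, ← Complex.exp_add]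
  congr 1
  push_cast
  ring

theorem etaDil_add_one (l : ℕ) (τ : ℂ) :
    etaDil l (τ + 1) = exp (2 * Real.pi * I / 24) ^ l * etaDil l τ := by
  unfold etaDil
  rw [mul_add, mul_one, eta_add_nat]

theorem exp_pow_24 : exp (2 * Real.pi * I / 24) ^ 24 = 1 := by
  rw [← Complex.exp_nat_mul, ← Complex.exp_two_pi_mul_I]
  congr 1
  push_cast
  ring

theorem uTau_periodic : Function.Periodic uTau 1 := by
  intro τ
  simp only [uTau, etaDil_add_one]
  have h := exp_pow_24
  set e := exp (2 * Real.pi * I / 24)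
  have he : e ≠ 0 := Complex.exp_ne_zero _
  have h1 : e ^ 1 * etaDil 1 τ * (e ^ 20 * etaDil 20 τ) / (e ^ 4 * etaDil 4 τ * (e ^ 5 * etaDil 5 τ))
      = e ^ 12 * (etaDil 1 τ * etaDil 20 τ / (etaDil 4 τ * etaDil 5 τ)) := by
    rw [show e ^ 1 * etaDil 1 τ * (e ^ 20 * etaDil 20 τ)
        = e ^ 9 * (e ^ 12 * (etaDil 1 τ * etaDil 20 τ)) by ring,
      show e ^ 4 * etaDil 4 τ * (e ^ 5 * etaDil 5 τ)
        = e ^ 9 * (etaDil 4 τ * etaDil 5 τ) by ring,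
      mul_div_mul_left _ _ (pow_ne_zero 9 he), mul_div_assoc]
  rw [h1, mul_pow, ← pow_mul, h, one_mul]

theorem zTau_periodic : Function.Periodic zTau 1 := by
  intro τ
  simp only [zTau, etaDil_add_one]
  have h := exp_pow_24
  linear_combination (etaDil 2 τ ^ 2 * etaDil 10 τ ^ 2) * h

theorem u_qParam (τ : ℂ) : u (exp (2 * Real.pi * I * τ)) = uTau τ := by
  have := Function.Periodic.eq_cuspFunction (h := 1) one_ne_zero
    (by simpa using uTau_periodic) τ
  simpa [Function.Periodic.qParam, u] using this

theorem z_qParam (τ : ℂ) : z (exp (2 * Real.pi * I * τ)) = zTau τ := by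
  have := Function.Periodic.eq_cuspFunction (h := 1) one_ne_zero
    (by simpa using zTau_periodic) τ
  simpa [Function.Periodic.qParam, z] using this

end LevelTwenty

end

noncomputable section

namespace LevelTwenty

open Complex Filter Topology

/-! Write a, b, p for `phi`, `phiNeg`, `psi` at q (p is Ramanujan's ψ at q²), A, B, P for their
values at q⁵, and f_k for `euler (q ^ k)`. The triple product makes a, b, p eta quotients, so that u
= q b P / (p B), Z = a² A² and z = q f₂² f₁₀². Put E = `eisen q` = (5A⁴ - a⁴)/4. The theorem rests
on three facts.

(1) q d/dq log u = E. Jacobi's formula gives the logarithmic derivative of θ₂/θ₄ as θ₃⁴/4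
(`thetaLog_psi_sub_phiNeg`), and u is, up to a constant factor, θ₄/θ₂ at q divided by θ₄/θ₂ at q⁵.

(2) 16z = (a² - A²)(5A² - a²), from `phiDiff_mul_dual`. With Z = a² A² this turns into E² = Z² -
12Zz + 16z² (`eisen_sq`).

(3) Zu = z(1 + u)² (`phi_mul_sq`), that is, X = u/(1 + u)².

Substituting (3) in (2) gives u²E² = z²(1 - 8u - 2u² - 8u³ + u⁴), which with (1) is the first
formula. Since q d/dq log X = E(1 - u)/(1 + u) and 1 - 4X = ((1 - u)/(1 + u))², the second follows
too.

Facts (2) and (3) come from one cubic. Splitting ℤ² into the cosets of (2 + i)ℤ[i] factors a² - A²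
and p² - q²P² as eta quotients (`phi_sq_sub`, `psi_sq_sub`). The resulting relations between q and
q⁵ are carried by τ ↦ -1/(5τ) to relations involving 5A² - a². Together they say that b/B, p/(qP)
and -a/A are the roots of t³ - x t² - 5t + x for a single x; the product of the roots gives (2) and
their sum gives (3). -/

/-! ### The Jacobi triple product, from its finite form. -/

/-- Euler's product `∏ (1 - q ^ n)` over `n ≥ 1`. -/
def euler (q : ℂ) : ℂ := ∏' n : ℕ, (1 - q ^ (n + 1))

theorem norm_pow_lt_one {q : ℂ} (hq : ‖q‖ < 1) {k : ℕ} (hk : k ≠ 0) : ‖q ^ k‖ < 1 := by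
  rw [norm_pow]
  exact pow_lt_one₀ (norm_nonneg _) hq hk

theorem one_sub_pow_ne_zero {q : ℂ} (hq : ‖q‖ < 1) (n : ℕ) : 1 - q ^ (n + 1) ≠ 0 := by
  intro h
  have h1 := norm_pow_lt_one hq n.succ_ne_zero
  rw [← sub_eq_zero.mp h] at h1
  simp at h1

theorem euler_ne_zero {q : ℂ} (hq : ‖q‖ < 1) : euler q ≠ 0 := by
  unfold euler
  simp_rw [sub_eq_add_neg]
  refine tprod_one_add_ne_zero_of_summable (f := fun n : ℕ ↦ -q ^ (n + 1)) (fun i ↦ ?_) ?_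
  · simpa [sub_eq_add_neg] using one_sub_pow_ne_zero hq i
  · simpa using (summable_nat_add_iff 1).mpr (summable_geometric_of_lt_one (norm_nonneg _) hq)

/-- The finite product `(Q; Q)_n`. -/
def poch (Q : ℂ) (n : ℕ) : ℂ := ∏ j ∈ Finset.range n, (1 - Q ^ (j + 1))

theorem poch_succ (Q : ℂ) (n : ℕ) : poch Q (n + 1) = poch Q n * (1 - Q ^ (n + 1)) :=
  Finset.prod_range_succ _ _

theorem poch_ne_zero {Q : ℂ} (hQ : ‖Q‖ < 1) (n : ℕ) : poch Q n ≠ 0 :=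
  Finset.prod_ne_zero_iff.mpr fun j _ ↦ one_sub_pow_ne_zero hQ j

theorem tendsto_poch {Q : ℂ} (hQ : ‖Q‖ < 1) : Tendsto (poch Q) atTop (𝓝 (euler Q)) :=
  (ModularForm.multipliable_one_sub_pow hQ).hasProd.tendsto_prod_nat

/-- `1 / (Q; Q)_m`, extended by zero to negative integers. -/
def invPoch (Q : ℂ) (m : ℤ) : ℂ := if 0 ≤ m then (poch Q m.toNat)⁻¹ else 0

/-- The extension by zero is what makes this recurrence hold for every integer: at m = 0 the factor
1 - Q⁰ vanishes. No boundary cases then arise for `tripleCoeff`. -/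
theorem invPoch_sub_one {Q : ℂ} (hQ : ‖Q‖ < 1) (m : ℤ) :
    invPoch Q (m - 1) = invPoch Q m * (1 - Q ^ m) := by
  rcases lt_trichotomy m 0 with h | h | h
  · simp [invPoch, not_le.mpr h, show ¬ (1 ≤ m) by omega]
  · simp [h, invPoch]
  · obtain ⟨n, rfl⟩ : ∃ n : ℕ, m = n + 1 := ⟨(m - 1).toNat, by omega⟩
    have e : ((n : ℤ) + 1).toNat = n + 1 := by omega
    have h1 := one_sub_pow_ne_zero hQ n
    have h2 := poch_ne_zero hQ n
    simp only [invPoch, add_sub_cancel_right, Int.natCast_nonneg, if_true, Int.toNat_natCast,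
      show (0 : ℤ) ≤ n + 1 by omega, e, poch_succ]
    rw [show ((n : ℤ) + 1) = ((n + 1 : ℕ) : ℤ) by push_cast; rfl, zpow_natCast]
    field_simp

theorem tendsto_invPoch {Q : ℂ} (hQ : ‖Q‖ < 1) : Tendsto (invPoch Q) atTop (𝓝 (euler Q)⁻¹) := by
  have h1 : Tendsto (fun m : ℤ ↦ (poch Q m.toNat)⁻¹) atTop (𝓝 (euler Q)⁻¹) := by
    refine ((tendsto_poch hQ).comp ?_).inv₀ (euler_ne_zero hQ)
    exact tendsto_atTop_atTop.mpr fun b ↦ ⟨b, fun a ha ↦ by omega⟩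
  refine h1.congr' ?_
  filter_upwards [eventually_ge_atTop 0] with m hm
  simp [invPoch, hm]

theorem exists_norm_invPoch_le {Q : ℂ} (hQ : ‖Q‖ < 1) : ∃ C, ∀ m, ‖invPoch Q m‖ ≤ C := by
  have h : Tendsto (fun n ↦ (poch Q n)⁻¹) atTop (𝓝 (euler Q)⁻¹) :=
    (tendsto_poch hQ).inv₀ (euler_ne_zero hQ)
  obtain ⟨C, hC⟩ := (Metric.isBounded_range_of_tendsto _ h).exists_norm_le
  refine ⟨C, fun m ↦ ?_⟩
  unfold invPoch
  split_ifs
  · exact hC _ ⟨_, rfl⟩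
  · simpa using (norm_nonneg _).trans (hC _ ⟨0, rfl⟩)

/-- The coefficients of the finite form of the Jacobi triple product, up to `(q²; q²)_{2n}`. -/
def tripleCoeff (q : ℂ) (n : ℕ) (k : ℤ) : ℂ :=
  q ^ (k ^ 2) * invPoch (q ^ 2) (n + k) * invPoch (q ^ 2) (n - k)

/-- Compares coefficients of w ^ k when the finite product is multiplied by (1 + w q^(2n+1))(1 + w⁻¹
q^(2n+1)) = 1 + q^(4n+2) + q^(2n+1)(w + w⁻¹). -/
theorem tripleCoeff_succ {q : ℂ} (hq0 : q ≠ 0) (hq : ‖q‖ < 1) (n : ℕ) (k : ℤ) :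
    (1 - q ^ (4 * n + 2)) * (1 - q ^ (4 * n + 4)) * tripleCoeff q (n + 1) k =
      (1 + q ^ (4 * n + 2)) * tripleCoeff q n k +
        q ^ (2 * n + 1) * (tripleCoeff q n (k - 1) + tripleCoeff q n (k + 1)) := by
  have hQ : ‖q ^ 2‖ < 1 := norm_pow_lt_one hq two_ne_zero
  have e1 : invPoch (q ^ 2) (n + k) =
      invPoch (q ^ 2) (n + 1 + k) * (1 - (q ^ 2) ^ ((n : ℤ) + 1 + k)) := by
    rw [← invPoch_sub_one hQ]; congr 1; ring
  have e2 : invPoch (q ^ 2) (n - k) =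
      invPoch (q ^ 2) (n + 1 - k) * (1 - (q ^ 2) ^ ((n : ℤ) + 1 - k)) := by
    rw [← invPoch_sub_one hQ]; congr 1; ring
  have e3 : invPoch (q ^ 2) (n + (k - 1)) =
      invPoch (q ^ 2) (n + k) * (1 - (q ^ 2) ^ ((n : ℤ) + k)) := by
    rw [← invPoch_sub_one hQ]; congr 1; ring
  have e4 : invPoch (q ^ 2) (n - (k + 1)) =
      invPoch (q ^ 2) (n - k) * (1 - (q ^ 2) ^ ((n : ℤ) - k)) := by
    rw [← invPoch_sub_one hQ]; congr 1; ring
  have e5 : invPoch (q ^ 2) (n - (k - 1)) = invPoch (q ^ 2) (n + 1 - k) := by congr 1; ring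
  have e6 : invPoch (q ^ 2) (n + (k + 1)) = invPoch (q ^ 2) (n + 1 + k) := by congr 1; ring
  have z1 : q ^ ((k - 1) ^ 2) = q ^ (k ^ 2) * (q ^ k)⁻¹ ^ 2 * q := by
    rw [show (k - 1) ^ 2 = k ^ 2 + (-k) + (-k) + 1 by ring]
    simp only [zpow_add₀ hq0, zpow_neg, zpow_one]; ring
  have z2 : q ^ ((k + 1) ^ 2) = q ^ (k ^ 2) * (q ^ k) ^ 2 * q := by
    rw [show (k + 1) ^ 2 = k ^ 2 + k + k + 1 by ring]
    simp only [zpow_add₀ hq0, zpow_one]; ring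
  have s (m : ℤ) : (q ^ 2) ^ m = (q ^ m) ^ 2 := by
    rw [← zpow_natCast, ← zpow_natCast, ← zpow_mul, ← zpow_mul, mul_comm]
  simp only [tripleCoeff]
  rw [e3, e4, e5, e6, e1, e2, z1, z2]
  push_cast
  simp only [s, zpow_add₀ hq0, zpow_sub₀ hq0, zpow_one, zpow_natCast]
  have hk : q ^ k ≠ 0 := zpow_ne_zero _ hq0
  have p1 : q ^ (4 * n + 2) = (q ^ n) ^ 4 * q ^ 2 := by ring
  have p2 : q ^ (4 * n + 4) = (q ^ n) ^ 4 * q ^ 4 := by ring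
  have p3 : q ^ (2 * n + 1) = (q ^ n) ^ 2 * q := by ring
  rw [p1, p2, p3]
  field_simp
  ring

theorem hasSum_tripleCoeff {q w : ℂ} (hq0 : q ≠ 0) (hq : ‖q‖ < 1) (hw : w ≠ 0) (n : ℕ) :
    HasSum (fun k : ℤ ↦ poch (q ^ 2) (2 * n) * tripleCoeff q n k * w ^ k)
      (∏ j ∈ Finset.range n, (1 + w * q ^ (2 * j + 1)) * (1 + w⁻¹ * q ^ (2 * j + 1))) := by
  induction n with
  | zero =>
    have h := hasSum_single (f := fun k : ℤ ↦ poch (q ^ 2) (2 * 0) * tripleCoeff q 0 k * w ^ k) 0 ?_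
    · simpa [poch, tripleCoeff, invPoch] using h
    · intro k hk
      rcases lt_or_gt_of_ne hk with h | h
      · simp [tripleCoeff, invPoch, not_le.mpr h]
      · simp [tripleCoeff, invPoch, not_le.mpr h]
  | succ n ih =>
    have h1 := (Equiv.subRight (1 : ℤ)).hasSum_iff.mpr ih
    have h2 := (Equiv.addRight (1 : ℤ)).hasSum_iff.mpr ih
    have h := (ih.mul_left (1 + q ^ (4 * n + 2))).add
      ((h1.mul_left (w * q ^ (2 * n + 1))).add (h2.mul_left (w⁻¹ * q ^ (2 * n + 1))))
    convert! h using 1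
    · funext k
      simp only [Function.comp_apply, Equiv.subRight_apply, Equiv.coe_addRight]
      rw [show 2 * (n + 1) = 2 * n + 1 + 1 by ring, poch_succ, poch_succ,
        zpow_sub₀ hw, zpow_add₀ hw, zpow_one, ← pow_mul, ← pow_mul]
      have := tripleCoeff_succ hq0 hq n k
      rw [show 2 * (2 * n + 1) = 4 * n + 2 by ring, show 2 * (2 * n + 1 + 1) = 4 * n + 4 by ring]
      have e : w * (w ^ k / w) = w ^ k := by field_simp
      have e' : w⁻¹ * (w ^ k * w) = w ^ k := by field_simp
      linear_combination (poch (q ^ 2) (2 * n) * w ^ k) * this -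
        q ^ (2 * n + 1) * poch (q ^ 2) (2 * n) * tripleCoeff q n (k - 1) * e -
        q ^ (2 * n + 1) * poch (q ^ 2) (2 * n) * tripleCoeff q n (k + 1) * e'
    · rw [Finset.prod_range_succ]
      have e : w * w⁻¹ = 1 := mul_inv_cancel₀ hw
      have p1 : q ^ (4 * n + 2) = (q ^ (2 * n + 1)) ^ 2 := by ring
      rw [p1]
      linear_combination (∏ j ∈ Finset.range n, (1 + w * q ^ (2 * j + 1)) *
        (1 + w⁻¹ * q ^ (2 * j + 1))) * (q ^ (2 * n + 1)) ^ 2 * e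

theorem exists_exp_pi_I {q : ℂ} (hq0 : q ≠ 0) (hq : ‖q‖ < 1) :
    ∃ τ : ℂ, 0 < τ.im ∧ exp (Real.pi * I * τ) = q := by
  refine ⟨log q / (Real.pi * I), ?_, ?_⟩
  · have : (log q / (Real.pi * I)) = ((log q).im / Real.pi : ℝ) + (-(log q).re / Real.pi : ℝ) * I := by
      have hpi : (Real.pi : ℂ) ≠ 0 := by exact_mod_cast Real.pi_ne_zero
      conv_lhs => rw [← re_add_im (log q)]
      push_cast
      field_simp
      linear_combination ((log q).re : ℂ) * I_sq
    rw [this]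
    simp only [add_im, ofReal_im, mul_im, ofReal_re, I_im, I_re, log_re]
    have := Real.log_neg (norm_pos_iff.mpr hq0) hq
    have := Real.pi_pos
    simp only [mul_one, zero_add, mul_zero, add_zero]
    apply div_pos <;> linarith
  · rw [mul_div_cancel₀, exp_log hq0]
    simp [Real.pi_ne_zero]

theorem summable_theta {q w : ℂ} (hq0 : q ≠ 0) (hq : ‖q‖ < 1) (hw : w ≠ 0) :
    Summable fun k : ℤ ↦ ‖q ^ (k ^ 2) * w ^ k‖ := by
  obtain ⟨τ, hτ, rfl⟩ := exists_exp_pi_I hq0 hq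
  have h := ((summable_jacobiTheta₂_term_iff (log w / (2 * Real.pi * I)) τ).mpr hτ).norm
  refine h.congr fun k ↦ ?_
  congr 1
  rw [jacobiTheta₂_term, exp_add, mul_comm]
  congr 1
  · rw [← exp_int_mul]; congr 1; push_cast; ring
  · conv_rhs => rw [← exp_log hw]
    rw [← exp_int_mul]; congr 1
    have := two_pi_I_ne_zero
    field_simp

theorem multipliable_one_add_geom {q : ℂ} (hq : ‖q‖ < 1) (w : ℂ) (m : ℕ) {d : ℕ} (hd : d ≠ 0) :
    Multipliable fun n : ℕ ↦ 1 + w * q ^ (d * n + m) := by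
  apply multipliable_one_add_of_summable
  have := (summable_geometric_of_lt_one (norm_nonneg _) (norm_pow_lt_one hq hd)).mul_left
    (‖w‖ * ‖q‖ ^ m)
  refine this.congr fun n ↦ ?_
  simp only [norm_mul, norm_pow, pow_add, pow_mul]
  ring

/-- The Jacobi triple product identity. -/
theorem jacobi_triple {q w : ℂ} (hq0 : q ≠ 0) (hq : ‖q‖ < 1) (hw : w ≠ 0) :
    ∑' k : ℤ, q ^ (k ^ 2) * w ^ k = euler (q ^ 2) *
      ((∏' n : ℕ, (1 + w * q ^ (2 * n + 1))) * ∏' n : ℕ, (1 + w⁻¹ * q ^ (2 * n + 1))) := by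
  have hQ : ‖q ^ 2‖ < 1 := norm_pow_lt_one hq two_ne_zero
  have hE := euler_ne_zero hQ
  obtain ⟨C, hC⟩ := exists_norm_invPoch_le hQ
  have hC0 : 0 ≤ C := (norm_nonneg _).trans (hC 0)
  have hs := summable_theta hq0 hq hw
  -- The reciprocal Pochhammer factors are uniformly bounded, so the theta series dominates and the
  -- limit can be taken term by term.
  have lim1 : Tendsto (fun n : ℕ ↦ ∑' k : ℤ, tripleCoeff q n k * w ^ k) atTop
      (𝓝 (∑' k : ℤ, (q ^ (k ^ 2) * (euler (q ^ 2))⁻¹ * (euler (q ^ 2))⁻¹) * w ^ k)) := by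
    refine tendsto_tsum_of_dominated_convergence (hs.mul_left (C * C)) (fun k ↦ ?_) ?_
    · refine Tendsto.mul_const _ (Tendsto.mul (Tendsto.const_mul _ ?_) ?_)
      · exact (tendsto_invPoch hQ).comp
          (tendsto_atTop_add_const_right _ _ tendsto_natCast_atTop_atTop)
      · exact (tendsto_invPoch hQ).comp
          (tendsto_atTop_add_const_right _ _ tendsto_natCast_atTop_atTop)
    · refine Eventually.of_forall fun n k ↦ ?_
      simp only [tripleCoeff, norm_mul]
      have a1 := hC (n + k)
      have a2 := hC (n - k)
      calc _ = ‖invPoch (q ^ 2) (n + k)‖ * ‖invPoch (q ^ 2) (n - k)‖ *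
          (‖q ^ k ^ 2‖ * ‖w ^ k‖) := by ring
        _ ≤ _ := by gcongr
  have lim2 : Tendsto (fun n : ℕ ↦ poch (q ^ 2) (2 * n) * ∑' k : ℤ, tripleCoeff q n k * w ^ k)
      atTop (𝓝 (euler (q ^ 2) *
        ∑' k : ℤ, (q ^ (k ^ 2) * (euler (q ^ 2))⁻¹ * (euler (q ^ 2))⁻¹) * w ^ k)) := by
    refine Tendsto.mul ((tendsto_poch hQ).comp ?_) lim1
    exact tendsto_id.const_mul_atTop' two_pos
  have lim3 : Tendsto (fun n : ℕ ↦ poch (q ^ 2) (2 * n) * ∑' k : ℤ, tripleCoeff q n k * w ^ k)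
      atTop (𝓝 ((∏' n : ℕ, (1 + w * q ^ (2 * n + 1))) * ∏' n : ℕ, (1 + w⁻¹ * q ^ (2 * n + 1)))) := by
    have t1 := (multipliable_one_add_geom hq w 1 two_ne_zero).hasProd.tendsto_prod_nat
    have t2 := (multipliable_one_add_geom hq w⁻¹ 1 two_ne_zero).hasProd.tendsto_prod_nat
    refine (t1.mul t2).congr fun n ↦ ?_
    rw [← Finset.prod_mul_distrib, ← (hasSum_tripleCoeff hq0 hq hw n).tsum_eq, ← tsum_mul_left]
    simp only [mul_assoc]
  rw [tendsto_nhds_unique lim3 lim2, ← tsum_mul_left, ← tsum_mul_left]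
  refine tsum_congr fun k ↦ ?_
  field_simp

/-! ### Dissection of infinite products by residue classes. -/

/-- The product of `1 + w q ^ (d n + m)` over `n ≥ 0`. -/
def geomProd (w q : ℂ) (d m : ℕ) : ℂ := ∏' n : ℕ, (1 + w * q ^ (d * n + m))

theorem geomProd_two {q : ℂ} (hq : ‖q‖ < 1) (w : ℂ) {d : ℕ} (hd : d ≠ 0) (m : ℕ) :
    geomProd w q d m = geomProd w q (2 * d) m * geomProd w q (2 * d) (d + m) := by
  have h1 := multipliable_one_add_geom hq w m (mul_ne_zero two_ne_zero hd)
  have h2 := multipliable_one_add_geom hq w (d + m) (mul_ne_zero two_ne_zero hd)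
  unfold geomProd
  rw [← tprod_even_mul_odd (f := fun n : ℕ ↦ 1 + w * q ^ (d * n + m))]
  · congr 1 <;> refine tprod_congr fun n ↦ ?_ <;> congr 3 <;> ring
  · exact h1.congr fun n ↦ by congr 3; ring
  · exact h2.congr fun n ↦ by congr 3; ring

theorem geomProd_five {q : ℂ} (hq : ‖q‖ < 1) (w : ℂ) {d : ℕ} (hd : d ≠ 0) (m : ℕ) :
    geomProd w q d m = geomProd w q (5 * d) m * geomProd w q (5 * d) (d + m) *
      geomProd w q (5 * d) (2 * d + m) * geomProd w q (5 * d) (3 * d + m) *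
      geomProd w q (5 * d) (4 * d + m) := by
  let e : Fin 5 × ℕ ≃ ℕ := (Equiv.prodComm _ _).trans (Nat.divModEquiv 5).symm
  have he (r : Fin 5) (n : ℕ) : e (r, n) = n * 5 + r := rfl
  have hm : Multipliable fun p ↦ 1 + w * q ^ (d * e p + m) :=
    (Equiv.multipliable_iff e).mpr (multipliable_one_add_geom hq w m hd)
  have h5 (r : Fin 5) : ∏' n : ℕ, (1 + w * q ^ (d * e (r, n) + m)) =
      geomProd w q (5 * d) (r * d + m) := by
    refine tprod_congr fun n ↦ ?_
    rw [he]; congr 3; ring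
  unfold geomProd
  rw [← e.tprod_eq, Multipliable.tprod_prod' hm, tprod_fintype]
  · simp only [h5, Fin.prod_univ_five]
    simp [geomProd]
  · intro r
    refine (multipliable_one_add_geom hq w (r * d + m) (mul_ne_zero (by norm_num : 5 ≠ 0) hd)).congr
      fun n ↦ ?_
    simp only [he]; congr 3; ring

theorem geomProd_mul {q : ℂ} {d : ℕ} (w : ℂ) (k m : ℕ) :
    geomProd w q (k * d) (k * m) = geomProd w (q ^ k) d m := by
  refine tprod_congr fun n ↦ ?_
  rw [← pow_mul]; congr 3; ring

theorem euler_eq_geomProd (q : ℂ) : euler q = geomProd (-1) q 1 1 := by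
  refine tprod_congr fun n ↦ ?_
  ring

theorem geomProd_neg_odd {q : ℂ} (hq : ‖q‖ < 1) :
    geomProd (-1) q 2 1 = euler q / euler (q ^ 2) := by
  have h2 := euler_ne_zero (norm_pow_lt_one hq two_ne_zero)
  have := geomProd_two hq (-1) one_ne_zero 1
  rw [eq_div_iff h2, euler_eq_geomProd q, euler_eq_geomProd (q ^ 2), ← geomProd_mul]
  exact this.symm

/-- Factor by factor, (1 + qⁿ)(1 - qⁿ) = 1 - q²ⁿ. -/
theorem geomProd_all {q : ℂ} (hq : ‖q‖ < 1) :
    geomProd 1 q 1 1 = euler (q ^ 2) / euler q := by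
  have h1 := multipliable_one_add_geom hq 1 1 one_ne_zero
  have h2 := multipliable_one_add_geom hq (-1) 1 one_ne_zero
  rw [eq_div_iff (euler_ne_zero hq), euler_eq_geomProd q, euler_eq_geomProd (q ^ 2)]
  unfold geomProd
  rw [← h1.tprod_mul h2]
  refine tprod_congr fun n ↦ ?_
  ring

theorem geomProd_odd {q : ℂ} (hq : ‖q‖ < 1) :
    geomProd 1 q 2 1 = euler (q ^ 2) ^ 2 / (euler q * euler (q ^ 4)) := by
  have h1 := euler_ne_zero hq
  have hq2 := norm_pow_lt_one hq two_ne_zero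
  have h2 := euler_ne_zero hq2
  have h4 := euler_ne_zero (norm_pow_lt_one hq four_ne_zero)
  have h := geomProd_two hq 1 one_ne_zero 1
  have e : geomProd 1 q (2 * 1) (1 + 1) = euler (q ^ 4) / euler (q ^ 2) := by
    rw [show (1 + 1) = 2 * 1 by rfl, geomProd_mul, geomProd_all hq2, ← pow_mul]
  rw [e, geomProd_all hq] at h
  change _ = geomProd 1 q 2 1 * _ at h
  field_simp at h ⊢
  linear_combination -h

/-- Replacing q by -q keeps the factors with even exponent and turns 1 - qⁿ into 1 + qⁿ for odd n.
-/
theorem euler_neg {q : ℂ} (hq : ‖q‖ < 1) :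
    euler (-q) = euler (q ^ 2) ^ 3 / (euler q * euler (q ^ 4)) := by
  have hq' : ‖-q‖ < 1 := by rwa [norm_neg]
  have h := geomProd_two hq' (-1) one_ne_zero 1
  rw [euler_eq_geomProd, h]
  have e1 : geomProd (-1) (-q) (2 * 1) 1 = geomProd 1 q 2 1 := by
    refine tprod_congr fun n ↦ ?_
    rw [Odd.neg_pow ⟨n, by ring⟩]; ring
  have e2 : geomProd (-1) (-q) (2 * 1) (1 + 1) = euler (q ^ 2) := by
    rw [euler_eq_geomProd, ← geomProd_mul]
    refine tprod_congr fun n ↦ ?_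
    rw [Even.neg_pow ⟨n + 1, by ring⟩]
  rw [e1, e2, geomProd_odd hq]
  ring

/-! ### Theta functions as series and as eta quotients. -/

/-- `∑ q ^ (n²)`, as a product. -/
def phi (q : ℂ) : ℂ := euler (q ^ 2) ^ 5 / (euler q ^ 2 * euler (q ^ 4) ^ 2)

/-- `∑ (-1) ^ n q ^ (n²)`, as a product. -/
def phiNeg (q : ℂ) : ℂ := euler q ^ 2 / euler (q ^ 2)

/-- Half of `∑ q ^ (n² + n)`, as a product. -/
def psi (q : ℂ) : ℂ := euler (q ^ 4) ^ 2 / euler (q ^ 2)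

theorem phi_eq_tsum {q : ℂ} (hq0 : q ≠ 0) (hq : ‖q‖ < 1) : ∑' k : ℤ, q ^ (k ^ 2) = phi q := by
  have h := jacobi_triple hq0 hq one_ne_zero
  have g := geomProd_odd hq
  have h2 := euler_ne_zero (norm_pow_lt_one hq two_ne_zero)
  simp only [one_zpow, mul_one, inv_one] at h
  unfold geomProd at g
  rw [h, g, phi]
  field_simp

theorem phiNeg_eq_tsum {q : ℂ} (hq0 : q ≠ 0) (hq : ‖q‖ < 1) :
    ∑' k : ℤ, q ^ (k ^ 2) * (-1) ^ k = phiNeg q := by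
  have h := jacobi_triple hq0 hq (neg_ne_zero.mpr one_ne_zero)
  have g := geomProd_neg_odd hq
  have h2 := euler_ne_zero (norm_pow_lt_one hq two_ne_zero)
  rw [show (-1 : ℂ)⁻¹ = -1 by norm_num] at h
  unfold geomProd at g
  rw [h, g, phiNeg]
  field_simp

theorem psi_eq_tsum {q : ℂ} (hq0 : q ≠ 0) (hq : ‖q‖ < 1) :
    ∑' k : ℤ, q ^ (k ^ 2) * q ^ k = 2 * psi q := by
  have hq2 := norm_pow_lt_one hq two_ne_zero
  have h := jacobi_triple hq0 hq hq0
  have g := geomProd_all hq2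
  have h2 := euler_ne_zero hq2
  have e1 : ∏' n : ℕ, (1 + q * q ^ (2 * n + 1)) = geomProd 1 (q ^ 2) 1 1 :=
    tprod_congr fun n ↦ by ring
  have e2 : ∏' n : ℕ, (1 + q⁻¹ * q ^ (2 * n + 1)) = 2 * geomProd 1 (q ^ 2) 1 1 := by
    have hm := multipliable_one_add_geom hq2 1 1 one_ne_zero
    -- The factor at n = 0 is 1 + q⁻¹q = 2; the remaining ones reproduce the first product.
    rw [tprod_eq_zero_mul']
    · congr 1
      · simp [hq0]; norm_num
      · exact tprod_congr fun n ↦ by field_simp; ring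
    · refine hm.congr fun n ↦ by field_simp; ring
  rw [h, e1, e2, g, psi, ← pow_mul]
  field_simp

theorem phi_neg {q : ℂ} (hq : ‖q‖ < 1) : phi (-q) = phiNeg q := by
  have h1 := euler_ne_zero hq
  have h2 := euler_ne_zero (norm_pow_lt_one hq two_ne_zero)
  have h4 := euler_ne_zero (norm_pow_lt_one hq four_ne_zero)
  rw [phi, phiNeg, euler_neg hq, neg_sq, Even.neg_pow ⟨2, rfl⟩]
  field_simp

/-- `∑ q ^ (5 k² + j k)`. -/
def quinTheta (q : ℂ) (j : ℕ) : ℂ := ∑' k : ℤ, (q ^ 5) ^ (k ^ 2) * (q ^ j) ^ k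

theorem quinTheta_eq {q : ℂ} (hq0 : q ≠ 0) (hq : ‖q‖ < 1) {j : ℕ} (hj : j < 5) :
    quinTheta q j = euler (q ^ 10) * (geomProd 1 q 10 (5 + j) * geomProd 1 q 10 (5 - j)) := by
  have h := jacobi_triple (pow_ne_zero 5 hq0) (norm_pow_lt_one hq (by norm_num : 5 ≠ 0))
    (pow_ne_zero j hq0)
  rw [quinTheta, h, ← pow_mul]
  congr 2
  · refine tprod_congr fun n ↦ ?_
    rw [one_mul, ← pow_mul, ← pow_add]; congr 2; ring
  · refine tprod_congr fun n ↦ ?_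
    rw [one_mul, ← pow_mul]
    congr 1
    rw [inv_mul_eq_iff_eq_mul₀ (pow_ne_zero j hq0), ← pow_add]
    congr 1; omega

/-- `(φ(q)² - φ(q⁵)²) / (4q)`, as a product. -/
def phiDiff (q : ℂ) : ℂ := euler (q ^ 2) ^ 2 * euler (q ^ 5) * euler (q ^ 20) /
  (euler q * euler (q ^ 4))

/-- `ψ(q²)² - q² ψ(q¹⁰)²`, as a product. -/
def psiDiff (q : ℂ) : ℂ := euler (q ^ 10) ^ 3 * euler (q ^ 4) / (euler (q ^ 2) * euler (q ^ 20))

/-- The two triple products run over exponents ≡ 9, 1 and 7, 3 mod 10: all the odd classes but 5.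
Hence they give the product over odd exponents divided by its part over multiples of 5. -/
theorem quinTheta_four_mul_two {q : ℂ} (hq0 : q ≠ 0) (hq : ‖q‖ < 1) :
    quinTheta q 4 * quinTheta q 2 = phiDiff q := by
  have hq5 := norm_pow_lt_one hq (by norm_num : 5 ≠ 0)
  have h1 := euler_ne_zero hq
  have h4 := euler_ne_zero (norm_pow_lt_one hq four_ne_zero)
  have h5 := euler_ne_zero hq5
  have h10 := euler_ne_zero (norm_pow_lt_one hq (by norm_num : 10 ≠ 0))
  have h20 := euler_ne_zero (norm_pow_lt_one hq (by norm_num : 20 ≠ 0))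
  have g := geomProd_five hq 1 two_ne_zero 1
  have g5 : geomProd 1 q 10 5 = euler (q ^ 10) ^ 2 / (euler (q ^ 5) * euler (q ^ 20)) := by
    have := geomProd_odd hq5
    rw [← geomProd_mul, ← pow_mul, ← pow_mul] at this
    exact this
  rw [geomProd_odd hq] at g
  norm_num at g
  rw [g5] at g
  rw [quinTheta_eq hq0 hq (by norm_num), quinTheta_eq hq0 hq (by norm_num), phiDiff]
  norm_num
  field_simp at g ⊢
  linear_combination (-1 : ℂ) * g

/-- Here the exponents are ≡ 8, 2 and 6, 4 mod 10, the even classes but 0. -/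
theorem quinTheta_three_mul_one {q : ℂ} (hq0 : q ≠ 0) (hq : ‖q‖ < 1) :
    quinTheta q 3 * quinTheta q 1 = psiDiff q := by
  have hq2 := norm_pow_lt_one hq two_ne_zero
  have hq10 := norm_pow_lt_one hq (by norm_num : 10 ≠ 0)
  have h2 := euler_ne_zero hq2
  have h10 := euler_ne_zero hq10
  have h20 := euler_ne_zero (norm_pow_lt_one hq (by norm_num : 20 ≠ 0))
  have g := geomProd_five hq 1 two_ne_zero 2
  have g2 : geomProd 1 q 2 2 = euler (q ^ 4) / euler (q ^ 2) := by
    have := geomProd_all hq2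
    rw [← geomProd_mul, ← pow_mul] at this
    exact this
  have g10 : geomProd 1 q 10 10 = euler (q ^ 20) / euler (q ^ 10) := by
    have := geomProd_all hq10
    rw [← geomProd_mul, ← pow_mul] at this
    exact this
  rw [g2] at g
  norm_num at g
  rw [g10] at g
  rw [quinTheta_eq hq0 hq (by norm_num), quinTheta_eq hq0 hq (by norm_num), psiDiff]
  norm_num
  field_simp at g ⊢
  linear_combination (-1 : ℂ) * g

/-! ### Dissection of double theta series over sublattices of ℤ². -/

/-- The lattice `ℤ²` is the disjoint union of the five cosets of `(2 + i) ℤ[i]`. -/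
theorem tsum_int_prod_five {f : ℤ × ℤ → ℂ} (hf : Summable f) (v : Fin 5 → ℤ × ℤ)
    (hv : ∀ j, ((v j).1 - 2 * (v j).2) % 5 = j) :
    ∑' x, f x = ∑ j, ∑' y : ℤ × ℤ, f ((v j).1 + (2 * y.1 - y.2), (v j).2 + (y.1 + 2 * y.2)) := by
  let g : Fin 5 × (ℤ × ℤ) → ℤ × ℤ :=
    fun p ↦ ((v p.1).1 + (2 * p.2.1 - p.2.2), (v p.1).2 + (p.2.1 + 2 * p.2.2))
  have hg : Function.Bijective g := by
    constructor
    · rintro ⟨i, k, l⟩ ⟨j, k', l'⟩ h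
      simp only [g, Prod.mk.injEq] at h
      have h1 := hv i
      have h2 := hv j
      have hij : i = j := by
        apply Fin.ext
        omega
      subst hij
      simp only [Prod.mk.injEq, true_and]
      omega
    · rintro ⟨m, n⟩
      have hr : ((m - 2 * n) % 5).toNat < 5 := by omega
      have hj := hv ⟨_, hr⟩
      -- Division by 2 + i: multiply the difference from the representative by 2 - i and divide by
      -- 5.
      refine ⟨⟨⟨_, hr⟩, (2 * (m - (v ⟨_, hr⟩).1) + (n - (v ⟨_, hr⟩).2)) / 5,
        (2 * (n - (v ⟨_, hr⟩).2) - (m - (v ⟨_, hr⟩).1)) / 5⟩, ?_⟩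
      simp only [g, Prod.mk.injEq]
      simp only at hj
      omega
  let e := Equiv.ofBijective g hg
  have hs : Summable fun p ↦ f (e p) := (Equiv.summable_iff e).mpr hf
  rw [← e.tsum_eq, hs.tsum_prod, tsum_fintype]
  rfl

/-- The checkerboard splitting of ℤ² by the parity of m - n, which underlies the duplication formula
for φ². -/
theorem tsum_int_prod_two {f : ℤ × ℤ → ℂ} (hf : Summable f) :
    ∑' x, f x = ∑' y : ℤ × ℤ, f (y.1 + y.2, y.1 - y.2) +
      ∑' y : ℤ × ℤ, f (y.1 + y.2 + 1, y.1 - y.2) := by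
  let g : Fin 2 × (ℤ × ℤ) → ℤ × ℤ := fun p ↦ (p.2.1 + p.2.2 + p.1, p.2.1 - p.2.2)
  have hg : Function.Bijective g := by
    constructor
    · rintro ⟨i, k, l⟩ ⟨j, k', l'⟩ h
      simp only [g, Prod.mk.injEq] at h
      have hij : i = j := by
        apply Fin.ext
        omega
      subst hij
      simp only [Prod.mk.injEq, true_and]
      omega
    · rintro ⟨m, n⟩
      have hr : ((m - n) % 2).toNat < 2 := by omega
      refine ⟨⟨⟨_, hr⟩, (m + n) / 2, (m - n) / 2⟩, ?_⟩
      simp only [g, Prod.mk.injEq]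
      omega
  let e := Equiv.ofBijective g hg
  have hs : Summable fun p ↦ f (e p) := (Equiv.summable_iff e).mpr hf
  rw [← e.tsum_eq, hs.tsum_prod, tsum_fintype, Fin.sum_univ_two]
  simp [e, g]

/-- `q ^ (c k² + j k)` is summable over the integers. -/
theorem summable_quadratic {q : ℂ} (hq0 : q ≠ 0) (hq : ‖q‖ < 1) {c : ℕ} (hc : c ≠ 0) (j : ℤ) :
    Summable fun k : ℤ ↦ ‖q ^ (c * k ^ 2 + j * k)‖ := by
  refine (summable_theta (pow_ne_zero c hq0) (norm_pow_lt_one hq hc)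
    (zpow_ne_zero j hq0)).congr fun k ↦ ?_
  rw [zpow_add₀ hq0, zpow_mul, zpow_mul, zpow_natCast]

theorem tsum_quadratic_mul {q : ℂ} (hq0 : q ≠ 0) (hq : ‖q‖ < 1) {c : ℕ} (hc : c ≠ 0) (i j : ℤ) :
    ∑' y : ℤ × ℤ, q ^ (c * y.1 ^ 2 + i * y.1 + (c * y.2 ^ 2 + j * y.2)) =
      (∑' k : ℤ, q ^ (c * k ^ 2 + i * k)) * ∑' k : ℤ, q ^ (c * k ^ 2 + j * k) := by
  rw [tsum_mul_tsum_of_summable_norm (summable_quadratic hq0 hq hc i)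
    (summable_quadratic hq0 hq hc j)]
  exact tsum_congr fun y ↦ zpow_add₀ hq0 _ _

theorem summable_quadratic_mul {q : ℂ} (hq0 : q ≠ 0) (hq : ‖q‖ < 1) {c : ℕ} (hc : c ≠ 0)
    (i j : ℤ) :
    Summable fun y : ℤ × ℤ ↦ q ^ (c * y.1 ^ 2 + i * y.1 + (c * y.2 ^ 2 + j * y.2)) := by
  refine (summable_mul_of_summable_norm (summable_quadratic hq0 hq hc i)
    (summable_quadratic hq0 hq hc j)).congr fun y ↦ ?_
  exact (zpow_add₀ hq0 _ _).symm

theorem tsum_quadratic_neg (q : ℂ) (c : ℕ) (j : ℤ) :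
    ∑' k : ℤ, q ^ (c * k ^ 2 + -j * k) = ∑' k : ℤ, q ^ (c * k ^ 2 + j * k) := by
  rw [← (Equiv.neg ℤ).tsum_eq]
  refine tsum_congr fun k ↦ ?_
  simp

theorem tsum_quadratic_zero (q : ℂ) (c : ℕ) :
    ∑' k : ℤ, q ^ (c * k ^ 2 + 0 * k) = ∑' k : ℤ, (q ^ c) ^ (k ^ 2) := by
  refine tsum_congr fun k ↦ ?_
  rw [zero_mul, add_zero, zpow_mul, zpow_natCast]

theorem tsum_quadratic_self {q : ℂ} (hq0 : q ≠ 0) (c : ℕ) :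
    ∑' k : ℤ, q ^ (c * k ^ 2 + c * k) = ∑' k : ℤ, (q ^ c) ^ (k ^ 2) * (q ^ c) ^ k := by
  refine tsum_congr fun k ↦ ?_
  rw [zpow_add₀ hq0, zpow_mul, zpow_mul, zpow_natCast]

theorem quinTheta_eq_tsum {q : ℂ} (hq0 : q ≠ 0) (j : ℕ) :
    ∑' k : ℤ, q ^ ((5 : ℕ) * k ^ 2 + j * k) = quinTheta q j := by
  refine tsum_congr fun k ↦ ?_
  rw [zpow_add₀ hq0, zpow_mul, zpow_mul, zpow_natCast, zpow_natCast]

/-- The duplication formula `φ(q)² = φ(q²)² + 4 q ψ(q⁴)²`. -/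
theorem phi_sq {q : ℂ} (hq : ‖q‖ < 1) : phi q ^ 2 = phi (q ^ 2) ^ 2 + 4 * q * psi (q ^ 2) ^ 2 := by
  by_cases hq0 : q = 0
  · simp [hq0, phi]
  have e2 := norm_pow_lt_one hq two_ne_zero
  have q2 := pow_ne_zero 2 hq0
  have h1 := tsum_quadratic_mul hq0 hq one_ne_zero 0 0
  have h2 := tsum_quadratic_mul hq0 hq two_ne_zero 0 0
  have h3 := tsum_quadratic_mul hq0 hq two_ne_zero (2 : ℕ) (2 : ℕ)
  rw [tsum_quadratic_zero, pow_one, phi_eq_tsum hq0 hq] at h1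
  rw [tsum_quadratic_zero, phi_eq_tsum q2 e2] at h2
  rw [tsum_quadratic_self hq0, psi_eq_tsum q2 e2] at h3
  have h := tsum_int_prod_two (summable_quadratic_mul hq0 hq one_ne_zero 0 0)
  rw [h1] at h
  have s : ∑' y : ℤ × ℤ, q ^ (((1 : ℕ) : ℤ) * (y.1 + y.2 + 1) ^ 2 + 0 * (y.1 + y.2 + 1) +
      (((1 : ℕ) : ℤ) * (y.1 - y.2) ^ 2 + 0 * (y.1 - y.2))) =
      q * (2 * psi (q ^ 2) * (2 * psi (q ^ 2))) := by
    rw [← h3, ← tsum_mul_left]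
    refine tsum_congr fun y ↦ ?_
    rw [← zpow_one_add₀ hq0]; congr 1; push_cast; ring
  have s' : ∑' y : ℤ × ℤ, q ^ (((1 : ℕ) : ℤ) * (y.1 + y.2) ^ 2 + 0 * (y.1 + y.2) +
      (((1 : ℕ) : ℤ) * (y.1 - y.2) ^ 2 + 0 * (y.1 - y.2))) = phi (q ^ 2) * phi (q ^ 2) := by
    rw [← h2]
    refine tsum_congr fun y ↦ ?_
    congr 1; push_cast; ring
  rw [s, s'] at h
  linear_combination h

/-- `φ(q)² - φ(q⁵)² = 4 q f(q, q⁹) f(q³, q⁷)`. -/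
theorem phi_sq_sub {q : ℂ} (hq : ‖q‖ < 1) :
    phi q ^ 2 - phi (q ^ 5) ^ 2 = 4 * q * phiDiff q := by
  by_cases hq0 : q = 0
  · simp [hq0]
  have five : (5 : ℕ) ≠ 0 := by norm_num
  have e5 := norm_pow_lt_one hq five
  have q5 := pow_ne_zero 5 hq0
  have h1 := tsum_quadratic_mul hq0 hq one_ne_zero 0 0
  rw [tsum_quadratic_zero, pow_one, phi_eq_tsum hq0 hq] at h1
  have h0 := tsum_quadratic_mul hq0 hq five 0 0
  rw [tsum_quadratic_zero, phi_eq_tsum q5 e5] at h0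
  have T4 := quinTheta_eq_tsum hq0 4
  have T2 := quinTheta_eq_tsum hq0 2
  have T4' := (tsum_quadratic_neg q 5 (4 : ℕ)).trans T4
  have T2' := (tsum_quadratic_neg q 5 (2 : ℕ)).trans T2
  -- The representatives are 0 and the four units of ℤ[i]. The zero coset scales the norm form by 5;
  -- each unit coset contributes the same product q · `quinTheta q 4` · `quinTheta q 2`, after
  -- changing signs of summation variables.
  have h := tsum_int_prod_five (summable_quadratic_mul hq0 hq one_ne_zero 0 0)
    ![(0, 0), (1, 0), (0, -1), (0, 1), (-1, 0)] (by decide)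
  have a1 := tsum_quadratic_mul hq0 hq five (4 : ℕ) (-(2 : ℕ))
  have a2 := tsum_quadratic_mul hq0 hq five (-(2 : ℕ)) (-(4 : ℕ))
  have a3 := tsum_quadratic_mul hq0 hq five (2 : ℕ) (4 : ℕ)
  have a4 := tsum_quadratic_mul hq0 hq five (-(4 : ℕ)) (2 : ℕ)
  rw [T4, T2'] at a1
  rw [T4', T2'] at a2
  rw [T4, T2] at a3
  rw [T4', T2] at a4
  have b0 : ∑' y : ℤ × ℤ, q ^ (((1 : ℕ) : ℤ) * (0 + (2 * y.1 - y.2)) ^ 2 +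
      0 * (0 + (2 * y.1 - y.2)) + (((1 : ℕ) : ℤ) * (0 + (y.1 + 2 * y.2)) ^ 2 +
      0 * (0 + (y.1 + 2 * y.2)))) = phi (q ^ 5) * phi (q ^ 5) := by
    rw [← h0]
    refine tsum_congr fun y ↦ ?_
    congr 1; push_cast; ring
  have b1 : ∑' y : ℤ × ℤ, q ^ (((1 : ℕ) : ℤ) * (1 + (2 * y.1 - y.2)) ^ 2 +
      0 * (1 + (2 * y.1 - y.2)) + (((1 : ℕ) : ℤ) * (0 + (y.1 + 2 * y.2)) ^ 2 +
      0 * (0 + (y.1 + 2 * y.2)))) = q * (quinTheta q 4 * quinTheta q 2) := by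
    rw [← a1, ← tsum_mul_left]
    refine tsum_congr fun y ↦ ?_
    rw [← zpow_one_add₀ hq0]; congr 1; push_cast; ring
  have b2 : ∑' y : ℤ × ℤ, q ^ (((1 : ℕ) : ℤ) * (0 + (2 * y.1 - y.2)) ^ 2 +
      0 * (0 + (2 * y.1 - y.2)) + (((1 : ℕ) : ℤ) * (-1 + (y.1 + 2 * y.2)) ^ 2 +
      0 * (-1 + (y.1 + 2 * y.2)))) = q * (quinTheta q 2 * quinTheta q 4) := by
    rw [← a2, ← tsum_mul_left]
    refine tsum_congr fun y ↦ ?_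
    rw [← zpow_one_add₀ hq0]; congr 1; push_cast; ring
  have b3 : ∑' y : ℤ × ℤ, q ^ (((1 : ℕ) : ℤ) * (0 + (2 * y.1 - y.2)) ^ 2 +
      0 * (0 + (2 * y.1 - y.2)) + (((1 : ℕ) : ℤ) * (1 + (y.1 + 2 * y.2)) ^ 2 +
      0 * (1 + (y.1 + 2 * y.2)))) = q * (quinTheta q 2 * quinTheta q 4) := by
    rw [← a3, ← tsum_mul_left]
    refine tsum_congr fun y ↦ ?_
    rw [← zpow_one_add₀ hq0]; congr 1; push_cast; ring
  have b4 : ∑' y : ℤ × ℤ, q ^ (((1 : ℕ) : ℤ) * (-1 + (2 * y.1 - y.2)) ^ 2 +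
      0 * (-1 + (2 * y.1 - y.2)) + (((1 : ℕ) : ℤ) * (0 + (y.1 + 2 * y.2)) ^ 2 +
      0 * (0 + (y.1 + 2 * y.2)))) = q * (quinTheta q 4 * quinTheta q 2) := by
    rw [← a4, ← tsum_mul_left]
    refine tsum_congr fun y ↦ ?_
    rw [← zpow_one_add₀ hq0]; congr 1; push_cast; ring
  rw [h1, Fin.sum_univ_five] at h
  simp only [Matrix.cons_val] at h
  rw [b0, b1, b2, b3, b4] at h
  rw [← quinTheta_four_mul_two hq0 hq]
  linear_combination h

/-- `ψ(q²)² - q² ψ(q¹⁰)² = f(q², q⁸) f(q⁴, q⁶)`. -/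
theorem psi_sq_sub {q : ℂ} (hq : ‖q‖ < 1) :
    psi q ^ 2 - q ^ 2 * psi (q ^ 5) ^ 2 = psiDiff q := by
  by_cases hq0 : q = 0
  · have h0 : euler 0 = 1 := by simp [euler]
    simp [hq0, psi, psiDiff, h0]
  have five : (5 : ℕ) ≠ 0 := by norm_num
  have e5 := norm_pow_lt_one hq five
  have q5 := pow_ne_zero 5 hq0
  have h1 := tsum_quadratic_mul hq0 hq one_ne_zero (1 : ℕ) (1 : ℕ)
  rw [tsum_quadratic_self hq0, pow_one, psi_eq_tsum hq0 hq] at h1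
  have h0 := tsum_quadratic_mul hq0 hq five (5 : ℕ) (5 : ℕ)
  rw [tsum_quadratic_self hq0, psi_eq_tsum q5 e5] at h0
  have T3 := quinTheta_eq_tsum hq0 3
  have T1 := quinTheta_eq_tsum hq0 1
  have T3' := (tsum_quadratic_neg q 5 (3 : ℕ)).trans T3
  have T1' := (tsum_quadratic_neg q 5 (1 : ℕ)).trans T1
  -- The form m² + m + n² + n is centred at (-1/2, -1/2). Four representatives are its zeros, so no
  -- power of q appears; the coset of (0, 1) gives 5(k² + k + l² + l) + 2, whence q² `psi (q ^ 5)`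
  -- ².
  have h := tsum_int_prod_five (summable_quadratic_mul hq0 hq one_ne_zero (1 : ℕ) (1 : ℕ))
    ![(0, 0), (-1, -1), (0, -1), (0, 1), (-1, 0)] (by decide)
  have a0 := tsum_quadratic_mul hq0 hq five (3 : ℕ) (1 : ℕ)
  have a1 := tsum_quadratic_mul hq0 hq five (-(3 : ℕ)) (-(1 : ℕ))
  have a2 := tsum_quadratic_mul hq0 hq five (1 : ℕ) (-(3 : ℕ))
  have a4 := tsum_quadratic_mul hq0 hq five (-(1 : ℕ)) (3 : ℕ)
  rw [T3, T1] at a0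
  rw [T3', T1'] at a1
  rw [T1, T3'] at a2
  rw [T1', T3] at a4
  have b0 : ∑' y : ℤ × ℤ, q ^ (((1 : ℕ) : ℤ) * (0 + (2 * y.1 - y.2)) ^ 2 +
      ((1 : ℕ) : ℤ) * (0 + (2 * y.1 - y.2)) + (((1 : ℕ) : ℤ) * (0 + (y.1 + 2 * y.2)) ^ 2 +
      ((1 : ℕ) : ℤ) * (0 + (y.1 + 2 * y.2)))) = quinTheta q 3 * quinTheta q 1 := by
    rw [← a0]
    refine tsum_congr fun y ↦ ?_
    congr 1; push_cast; ring
  have b1 : ∑' y : ℤ × ℤ, q ^ (((1 : ℕ) : ℤ) * (-1 + (2 * y.1 - y.2)) ^ 2 +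
      ((1 : ℕ) : ℤ) * (-1 + (2 * y.1 - y.2)) + (((1 : ℕ) : ℤ) * (-1 + (y.1 + 2 * y.2)) ^ 2 +
      ((1 : ℕ) : ℤ) * (-1 + (y.1 + 2 * y.2)))) = quinTheta q 3 * quinTheta q 1 := by
    rw [← a1]
    refine tsum_congr fun y ↦ ?_
    congr 1; push_cast; ring
  have b2 : ∑' y : ℤ × ℤ, q ^ (((1 : ℕ) : ℤ) * (0 + (2 * y.1 - y.2)) ^ 2 +
      ((1 : ℕ) : ℤ) * (0 + (2 * y.1 - y.2)) + (((1 : ℕ) : ℤ) * (-1 + (y.1 + 2 * y.2)) ^ 2 +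
      ((1 : ℕ) : ℤ) * (-1 + (y.1 + 2 * y.2)))) = quinTheta q 1 * quinTheta q 3 := by
    rw [← a2]
    refine tsum_congr fun y ↦ ?_
    congr 1; push_cast; ring
  have b3 : ∑' y : ℤ × ℤ, q ^ (((1 : ℕ) : ℤ) * (0 + (2 * y.1 - y.2)) ^ 2 +
      ((1 : ℕ) : ℤ) * (0 + (2 * y.1 - y.2)) + (((1 : ℕ) : ℤ) * (1 + (y.1 + 2 * y.2)) ^ 2 +
      ((1 : ℕ) : ℤ) * (1 + (y.1 + 2 * y.2)))) =
      q ^ 2 * (2 * psi (q ^ 5) * (2 * psi (q ^ 5))) := by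
    rw [← h0, ← tsum_mul_left]
    refine tsum_congr fun y ↦ ?_
    rw [← zpow_natCast, ← zpow_add₀ hq0]; congr 1; push_cast; ring
  have b4 : ∑' y : ℤ × ℤ, q ^ (((1 : ℕ) : ℤ) * (-1 + (2 * y.1 - y.2)) ^ 2 +
      ((1 : ℕ) : ℤ) * (-1 + (2 * y.1 - y.2)) + (((1 : ℕ) : ℤ) * (0 + (y.1 + 2 * y.2)) ^ 2 +
      ((1 : ℕ) : ℤ) * (0 + (y.1 + 2 * y.2)))) = quinTheta q 1 * quinTheta q 3 := by
    rw [← a4]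
    refine tsum_congr fun y ↦ ?_
    congr 1; push_cast; ring
  rw [h1, Fin.sum_univ_five] at h
  simp only [Matrix.cons_val] at h
  rw [b0, b1, b2, b3, b4] at h
  rw [← quinTheta_three_mul_one hq0 hq]
  linear_combination h / 4

/-! ### Analyticity, duplication formulas and logarithmic derivatives of theta functions. -/

theorem differentiableAt_euler {q : ℂ} (hq : ‖q‖ < 1) : DifferentiableAt ℂ euler q :=
  ModularForm.differentiableOn_tprod_one_sub_pow.differentiableAt
    (Metric.isOpen_ball.mem_nhds (by simpa using hq))

theorem differentiableAt_euler_pow {q : ℂ} (hq : ‖q‖ < 1) {k : ℕ} (hk : k ≠ 0) :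
    DifferentiableAt ℂ (fun x ↦ euler (x ^ k)) q :=
  (differentiableAt_euler (norm_pow_lt_one hq hk)).comp q (differentiableAt_pow k)

theorem euler_pow_ne_zero {q : ℂ} (hq : ‖q‖ < 1) {k : ℕ} (hk : k ≠ 0) : euler (q ^ k) ≠ 0 :=
  euler_ne_zero (norm_pow_lt_one hq hk)

theorem euler_zero : euler 0 = 1 := by simp [euler]

theorem phi_zero : phi 0 = 1 := by simp [phi, euler_zero]

theorem phiNeg_zero : phiNeg 0 = 1 := by simp [phiNeg, euler_zero]

theorem psi_zero : psi 0 = 1 := by simp [psi, euler_zero]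

theorem phi_ne_zero {q : ℂ} (hq : ‖q‖ < 1) : phi q ≠ 0 :=
  div_ne_zero (pow_ne_zero _ (euler_pow_ne_zero hq two_ne_zero)) (mul_ne_zero
    (pow_ne_zero _ (euler_ne_zero hq)) (pow_ne_zero _ (euler_pow_ne_zero hq four_ne_zero)))

theorem phiNeg_ne_zero {q : ℂ} (hq : ‖q‖ < 1) : phiNeg q ≠ 0 :=
  div_ne_zero (pow_ne_zero _ (euler_ne_zero hq)) (euler_pow_ne_zero hq two_ne_zero)

theorem psi_ne_zero {q : ℂ} (hq : ‖q‖ < 1) : psi q ≠ 0 :=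
  div_ne_zero (pow_ne_zero _ (euler_pow_ne_zero hq four_ne_zero)) (euler_pow_ne_zero hq two_ne_zero)

theorem differentiableAt_phi {q : ℂ} (hq : ‖q‖ < 1) : DifferentiableAt ℂ phi q :=
  ((differentiableAt_euler_pow hq two_ne_zero).pow 5).fun_div
    (((differentiableAt_euler hq).pow 2).mul ((differentiableAt_euler_pow hq four_ne_zero).pow 2))
    (mul_ne_zero (pow_ne_zero _ (euler_ne_zero hq))
      (pow_ne_zero _ (euler_pow_ne_zero hq four_ne_zero)))

theorem differentiableAt_phiNeg {q : ℂ} (hq : ‖q‖ < 1) : DifferentiableAt ℂ phiNeg q :=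
  ((differentiableAt_euler hq).pow 2).fun_div (differentiableAt_euler_pow hq two_ne_zero)
    (euler_pow_ne_zero hq two_ne_zero)

theorem differentiableAt_psi {q : ℂ} (hq : ‖q‖ < 1) : DifferentiableAt ℂ psi q :=
  ((differentiableAt_euler_pow hq four_ne_zero).pow 2).fun_div
    (differentiableAt_euler_pow hq two_ne_zero) (euler_pow_ne_zero hq two_ne_zero)

theorem phi_mul_phiNeg {q : ℂ} (hq : ‖q‖ < 1) : phi q * phiNeg q = phiNeg (q ^ 2) ^ 2 := by
  have h1 := euler_ne_zero hq
  have h2 := euler_pow_ne_zero hq two_ne_zero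
  have h4 := euler_pow_ne_zero hq four_ne_zero
  simp only [phi, phiNeg, ← pow_mul]
  norm_num
  field_simp

theorem psi_sq {q : ℂ} (hq : ‖q‖ < 1) : psi q ^ 2 = phi (q ^ 2) * psi (q ^ 2) := by
  have h2 := euler_pow_ne_zero hq two_ne_zero
  have h4 := euler_pow_ne_zero hq four_ne_zero
  have h8 := euler_pow_ne_zero hq (by norm_num : 8 ≠ 0)
  simp only [phi, psi, ← pow_mul]
  norm_num
  field_simp

theorem phiNeg_sq {q : ℂ} (hq : ‖q‖ < 1) :
    phiNeg q ^ 2 = phi (q ^ 2) ^ 2 - 4 * q * psi (q ^ 2) ^ 2 := by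
  have h := phi_sq (q := -q) (by rwa [norm_neg])
  rw [phi_neg hq, neg_sq] at h
  linear_combination h

theorem eventually_norm_lt_one {q : ℂ} (hq : ‖q‖ < 1) : ∀ᶠ x in 𝓝 q, ‖x‖ < 1 :=
  continuous_norm.continuousAt.eventually_lt_const hq

/-- The logarithmic derivative with respect to `log q`. -/
def thetaLog (f : ℂ → ℂ) (q : ℂ) : ℂ := q * logDeriv f q

theorem mul_deriv_eq {f : ℂ → ℂ} {q : ℂ} (hf : f q ≠ 0) : q * deriv f q = thetaLog f q * f q := by
  rw [thetaLog, logDeriv_apply]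
  field_simp

theorem hasDerivAt_comp_sq {f : ℂ → ℂ} {q : ℂ} (hf : DifferentiableAt ℂ f (q ^ 2)) :
    HasDerivAt (fun x ↦ f (x ^ 2)) (deriv f (q ^ 2) * (2 * q)) q := by
  have := hf.hasDerivAt.comp q (hasDerivAt_pow 2 q)
  simpa [Function.comp_def] using this

theorem thetaLog_psi {q : ℂ} (hq : ‖q‖ < 1) :
    thetaLog psi q = thetaLog phi (q ^ 2) + thetaLog psi (q ^ 2) := by
  have hq2 := norm_pow_lt_one hq two_ne_zero
  have h1 := (differentiableAt_psi hq).hasDerivAt.pow 2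
  have h2 := (hasDerivAt_comp_sq (differentiableAt_phi hq2)).mul
    (hasDerivAt_comp_sq (differentiableAt_psi hq2))
  have he : (psi ^ 2 : ℂ → ℂ) =ᶠ[𝓝 q] fun x ↦ phi (x ^ 2) * psi (x ^ 2) := by
    filter_upwards [eventually_norm_lt_one hq] with x hx using psi_sq hx
  have h := h1.unique (h2.congr_of_eventuallyEq he)
  have n1 := phi_ne_zero hq2
  have n2 := psi_ne_zero hq2
  have d0 := mul_deriv_eq (psi_ne_zero hq)
  have d1 := mul_deriv_eq n1
  have d2 := mul_deriv_eq n2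
  have hs := psi_sq hq
  simp only [Nat.cast_ofNat, Nat.add_one_sub_one, pow_one] at h
  refine mul_right_cancel₀ (mul_ne_zero n1 n2) ?_
  linear_combination q / 2 * h - psi q * d0 + psi (q ^ 2) * d1 + phi (q ^ 2) * d2 -
    thetaLog psi q * hs

theorem thetaLog_phi {q : ℂ} (hq : ‖q‖ < 1) :
    thetaLog phi q * phi q ^ 2 = 2 * thetaLog phi (q ^ 2) * phi (q ^ 2) ^ 2 +
      2 * q * psi (q ^ 2) ^ 2 * (1 + 4 * thetaLog psi (q ^ 2)) := by
  have hq2 := norm_pow_lt_one hq two_ne_zero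
  have h1 := (differentiableAt_phi hq).hasDerivAt.pow 2
  have h2 := ((hasDerivAt_comp_sq (differentiableAt_phi hq2)).pow 2).add
    (((hasDerivAt_id q).const_mul 4).mul
      ((hasDerivAt_comp_sq (differentiableAt_psi hq2)).pow 2))
  have he : (phi ^ 2 : ℂ → ℂ) =ᶠ[𝓝 q] (fun x ↦ phi (x ^ 2)) ^ 2 +
      (fun x ↦ 4 * id x) * (fun x ↦ psi (x ^ 2)) ^ 2 := by
    filter_upwards [eventually_norm_lt_one hq] with x hx using phi_sq hx
  have h := h1.unique (h2.congr_of_eventuallyEq he)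
  have d0 := mul_deriv_eq (phi_ne_zero hq)
  have d1 := mul_deriv_eq (phi_ne_zero hq2)
  have d2 := mul_deriv_eq (psi_ne_zero hq2)
  simp only [Nat.cast_ofNat, Nat.add_one_sub_one, pow_one, id_eq, mul_one, Pi.pow_apply] at h
  linear_combination q / 2 * h - phi q * d0 + 2 * phi (q ^ 2) * d1 + 8 * q * psi (q ^ 2) * d2

theorem thetaLog_phiNeg {q : ℂ} (hq : ‖q‖ < 1) :
    thetaLog phiNeg q * phiNeg q ^ 2 = 2 * thetaLog phi (q ^ 2) * phi (q ^ 2) ^ 2 -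
      2 * q * psi (q ^ 2) ^ 2 * (1 + 4 * thetaLog psi (q ^ 2)) := by
  have hq2 := norm_pow_lt_one hq two_ne_zero
  have h1 := (differentiableAt_phiNeg hq).hasDerivAt.pow 2
  have h2 := ((hasDerivAt_comp_sq (differentiableAt_phi hq2)).pow 2).sub
    (((hasDerivAt_id q).const_mul 4).mul
      ((hasDerivAt_comp_sq (differentiableAt_psi hq2)).pow 2))
  have he : (phiNeg ^ 2 : ℂ → ℂ) =ᶠ[𝓝 q] (fun x ↦ phi (x ^ 2)) ^ 2 -
      (fun x ↦ 4 * id x) * (fun x ↦ psi (x ^ 2)) ^ 2 := by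
    filter_upwards [eventually_norm_lt_one hq] with x hx using phiNeg_sq hx
  have h := h1.unique (h2.congr_of_eventuallyEq he)
  have d0 := mul_deriv_eq (phiNeg_ne_zero hq)
  have d1 := mul_deriv_eq (phi_ne_zero hq2)
  have d2 := mul_deriv_eq (psi_ne_zero hq2)
  simp only [Nat.cast_ofNat, Nat.add_one_sub_one, pow_one, id_eq, mul_one, Pi.pow_apply] at h
  linear_combination q / 2 * h - phiNeg q * d0 + 2 * phi (q ^ 2) * d1 - 8 * q * psi (q ^ 2) * d2

theorem continuousAt_thetaLog_zero {f : ℂ → ℂ} (hf : ∀ q, ‖q‖ < 1 → DifferentiableAt ℂ f q)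
    (h0 : f 0 ≠ 0) : ContinuousAt (thetaLog f) 0 := by
  have hd : DifferentiableOn ℂ f (Metric.ball 0 1) := fun q hq ↦
    (hf q (by simpa using hq)).differentiableWithinAt
  have ha : AnalyticAt ℂ f 0 := hd.analyticAt (Metric.ball_mem_nhds 0 one_pos)
  exact continuousAt_id.mul (ha.deriv.continuousAt.div ha.continuousAt h0)

/-- A function that is continuous at `0` and invariant under `q ↦ q²` is constant. -/
theorem eq_of_invariant_sq {G : ℂ → ℂ} (hG : ContinuousAt G 0)
    (h : ∀ q, ‖q‖ < 1 → G q = G (q ^ 2)) {q : ℂ} (hq : ‖q‖ < 1) : G q = G 0 := by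
  have h1 (n : ℕ) : G (q ^ 2 ^ n) = G q := by
    induction n with
    | zero => simp
    | succ n ih => rw [pow_succ, pow_mul, ← h _ (norm_pow_lt_one hq (by positivity)), ih]
  have h2 : Tendsto (fun n : ℕ ↦ q ^ 2 ^ n) atTop (𝓝 0) :=
    (tendsto_pow_atTop_nhds_zero_of_norm_lt_one hq).comp
      (tendsto_pow_atTop_atTop_of_one_lt one_lt_two)
  have h3 := hG.tendsto.comp h2
  refine tendsto_nhds_unique ?_ h3
  simp [Function.comp_def, h1]

/-- Jacobi's formula for the derivative of log(θ₂/θ₃), the 1 coming from the factor q^(1/4) of θ₂.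
The duplication formulas show that the quotient of the two sides is invariant under q ↦ q²; being
continuous at 0 with value 1 there, it is 1. -/
theorem thetaLog_psi_sub_phi {q : ℂ} (hq : ‖q‖ < 1) :
    1 + 4 * thetaLog psi q - 4 * thetaLog phi q = phiNeg q ^ 4 := by
  let L : ℂ → ℂ := fun q ↦ 1 + 4 * thetaLog psi q - 4 * thetaLog phi q
  have hL (q : ℂ) (hq : ‖q‖ < 1) : L q * phiNeg (q ^ 2) ^ 4 = L (q ^ 2) * phiNeg q ^ 4 := by
    have e1 := thetaLog_psi hq
    have e2 := thetaLog_phi hq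
    have e3 := phi_sq hq
    have e4 := phiNeg_sq hq
    have e5 := phi_mul_phiNeg hq
    have h : L q * phi q ^ 2 = L (q ^ 2) * phiNeg q ^ 2 := by
      simp only [L]
      linear_combination 4 * phi q ^ 2 * e1 - 4 * e2 +
        (1 + 4 * thetaLog phi (q ^ 2) + 4 * thetaLog psi (q ^ 2)) * e3 -
        (1 + 4 * thetaLog psi (q ^ 2) - 4 * thetaLog phi (q ^ 2)) * e4
    linear_combination phiNeg q ^ 2 * h -
      L q * (phiNeg (q ^ 2) ^ 2 + phi q * phiNeg q) * e5
  have hc : ContinuousAt (fun q ↦ L q / phiNeg q ^ 4) 0 := by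
    refine ContinuousAt.div ?_ ((differentiableAt_phiNeg (by simp)).continuousAt.pow 4)
      (by simp [phiNeg_zero])
    refine ((continuousAt_const.add (continuousAt_const.mul ?_)).sub (continuousAt_const.mul ?_))
    · exact continuousAt_thetaLog_zero (fun _ h ↦ differentiableAt_psi h) (by simp [psi_zero])
    · exact continuousAt_thetaLog_zero (fun _ h ↦ differentiableAt_phi h) (by simp [phi_zero])
  have h := eq_of_invariant_sq hc (fun q hq ↦ ?_) hq
  · have n := pow_ne_zero 4 (phiNeg_ne_zero hq)
    simp only [L, phiNeg_zero, thetaLog] at h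
    rw [div_eq_iff n] at h
    simpa [thetaLog] using h
  · have n1 := pow_ne_zero 4 (phiNeg_ne_zero hq)
    have n2 := pow_ne_zero 4 (phiNeg_ne_zero (norm_pow_lt_one hq two_ne_zero))
    rw [div_eq_div_iff n1 n2, hL q hq]

/-- The companion for log(θ₂/θ₄), deduced from the previous formula at q² by one duplication step.
-/
theorem thetaLog_psi_sub_phiNeg {q : ℂ} (hq : ‖q‖ < 1) :
    1 + 4 * thetaLog psi q - 4 * thetaLog phiNeg q = phi q ^ 4 := by
  have e0 := thetaLog_psi_sub_phi (norm_pow_lt_one hq two_ne_zero)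
  have e1 := thetaLog_psi hq
  have e2 := thetaLog_phiNeg hq
  have e3 := phi_sq hq
  have e4 := phiNeg_sq hq
  have e5 := phi_mul_phiNeg hq
  refine mul_right_cancel₀ (pow_ne_zero 2 (phiNeg_ne_zero hq)) ?_
  linear_combination 4 * phiNeg q ^ 2 * e1 - 4 * e2 +
    (1 + 4 * thetaLog phi (q ^ 2) + 4 * thetaLog psi (q ^ 2)) * e4 -
    (1 + 4 * thetaLog psi (q ^ 2) - 4 * thetaLog phi (q ^ 2)) * e3 + phi q ^ 2 * e0 -
    phi q ^ 2 * (phiNeg (q ^ 2) ^ 2 + phi q * phiNeg q) * e5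

/-! ### Relations of degree five and their images under τ ↦ -1/(5τ). -/

/-- With the two analogues below, this shows that `phiDiff q` ² A/a, its image under q ↦ -q, and
`psiDiff q` ² P/p share the value f₁₀⁵/f₂. This common value links the three theta functions. -/
theorem phiDiff_sq {q : ℂ} (hq : ‖q‖ < 1) :
    phiDiff q ^ 2 * phi (q ^ 5) * euler (q ^ 2) = euler (q ^ 10) ^ 5 * phi q := by
  have h1 := euler_ne_zero hq
  have h2 := euler_pow_ne_zero hq two_ne_zero
  have h4 := euler_pow_ne_zero hq four_ne_zero
  have h5 := euler_pow_ne_zero hq (by norm_num : 5 ≠ 0)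
  have h20 := euler_pow_ne_zero hq (by norm_num : 20 ≠ 0)
  simp only [phi, phiDiff, ← pow_mul]
  norm_num
  field_simp

theorem phiDiff_neg_sq {q : ℂ} (hq : ‖q‖ < 1) :
    phiDiff (-q) ^ 2 * phiNeg (q ^ 5) * euler (q ^ 2) = euler (q ^ 10) ^ 5 * phiNeg q := by
  have h := phiDiff_sq (q := -q) (by rwa [norm_neg])
  rwa [phi_neg hq, neg_sq, Odd.neg_pow (by decide : Odd 5), Even.neg_pow (by decide : Even 10),
    phi_neg (norm_pow_lt_one hq (by norm_num))] at h

theorem psiDiff_sq {q : ℂ} (hq : ‖q‖ < 1) :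
    psiDiff q ^ 2 * psi (q ^ 5) * euler (q ^ 2) = euler (q ^ 10) ^ 5 * psi q := by
  have h2 := euler_pow_ne_zero hq two_ne_zero
  have h10 := euler_pow_ne_zero hq (by norm_num : 10 ≠ 0)
  have h20 := euler_pow_ne_zero hq (by norm_num : 20 ≠ 0)
  simp only [psi, psiDiff, ← pow_mul]
  norm_num
  field_simp

theorem phiNeg_sq_sub {q : ℂ} (hq : ‖q‖ < 1) :
    phiNeg q ^ 2 - phiNeg (q ^ 5) ^ 2 = -4 * q * phiDiff (-q) := by
  have h := phi_sq_sub (q := -q) (by rwa [norm_neg])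
  rw [phi_neg hq, Odd.neg_pow (by decide : Odd 5),
    phi_neg (norm_pow_lt_one hq (by norm_num))] at h
  linear_combination h

/-- The theta constant `θ₃`. -/
def thetaThree (τ : ℂ) : ℂ := phi (exp (Real.pi * I * τ))

/-- The theta constant `θ₄`. -/
def thetaFour (τ : ℂ) : ℂ := phiNeg (exp (Real.pi * I * τ))

/-- The theta constant `θ₂`. -/
def thetaTwo (τ : ℂ) : ℂ := 2 * exp (Real.pi * I * τ / 4) * psi (exp (Real.pi * I * τ))

theorem norm_exp_pi_I_lt_one {τ : ℂ} (hτ : 0 < τ.im) : ‖exp (Real.pi * I * τ)‖ < 1 := by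
  rw [norm_exp]
  have : (Real.pi * I * τ).re = -(Real.pi * τ.im) := by simp
  rw [this, Real.exp_lt_one_iff]
  have := mul_pos Real.pi_pos hτ
  linarith

theorem thetaThree_eq {τ : ℂ} (hτ : 0 < τ.im) : thetaThree τ = jacobiTheta₂ 0 τ := by
  rw [thetaThree, ← phi_eq_tsum (exp_ne_zero _) (norm_exp_pi_I_lt_one hτ)]
  refine tsum_congr fun k ↦ ?_
  rw [jacobiTheta₂_term, ← exp_int_mul]
  congr 1; push_cast; ring

theorem thetaFour_eq {τ : ℂ} (hτ : 0 < τ.im) : thetaFour τ = jacobiTheta₂ (1 / 2) τ := by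
  rw [thetaFour, ← phiNeg_eq_tsum (exp_ne_zero _) (norm_exp_pi_I_lt_one hτ)]
  refine tsum_congr fun k ↦ ?_
  rw [jacobiTheta₂_term, ← exp_pi_mul_I, ← exp_int_mul, ← exp_int_mul, ← exp_add]
  congr 1; push_cast; ring

theorem thetaTwo_eq {τ : ℂ} (hτ : 0 < τ.im) :
    thetaTwo τ = exp (Real.pi * I * τ / 4) * jacobiTheta₂ (τ / 2) τ := by
  have h := psi_eq_tsum (exp_ne_zero _) (norm_exp_pi_I_lt_one hτ)
  rw [thetaTwo, mul_comm 2, mul_assoc, ← h]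
  congr 1
  refine tsum_congr fun k ↦ ?_
  rw [jacobiTheta₂_term, ← exp_int_mul, ← exp_int_mul, ← exp_add]
  congr 1; push_cast; ring

theorem im_neg_one_div_pos {τ : ℂ} (hτ : 0 < τ.im) : 0 < (-1 / τ).im := by
  have h0 : τ ≠ 0 := by rintro rfl; simp at hτ
  rw [neg_div, neg_im, one_div, inv_im, neg_div, neg_neg]
  exact div_pos hτ (normSq_pos.mpr h0)

theorem sqrt_neg_I_mul_ne_zero {τ : ℂ} (hτ : 0 < τ.im) : (-I * τ) ^ (1 / 2 : ℂ) ≠ 0 := by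
  have h0 : τ ≠ 0 := by rintro rfl; simp at hτ
  rw [Ne, cpow_eq_zero_iff]
  simp [h0]

theorem thetaThree_neg_inv {τ : ℂ} (hτ : 0 < τ.im) :
    thetaThree (-1 / τ) = (-I * τ) ^ (1 / 2 : ℂ) * thetaThree τ := by
  have h := jacobiTheta₂_functional_equation 0 τ
  have hr := sqrt_neg_I_mul_ne_zero hτ
  rw [← thetaThree_eq hτ, zero_div, ← thetaThree_eq (im_neg_one_div_pos hτ)] at h
  have e : -Real.pi * I * 0 ^ 2 / τ = 0 := by ring
  rw [h, e, exp_zero, mul_one, ← mul_assoc, mul_one_div_cancel hr, one_mul]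

theorem thetaTwo_neg_inv {τ : ℂ} (hτ : 0 < τ.im) :
    thetaTwo (-1 / τ) = (-I * τ) ^ (1 / 2 : ℂ) * thetaFour τ := by
  have h0 : τ ≠ 0 := by rintro rfl; simp at hτ
  have h := jacobiTheta₂_functional_equation (1 / 2) τ
  have hr := sqrt_neg_I_mul_ne_zero hτ
  rw [thetaFour_eq hτ, h, thetaTwo_eq (im_neg_one_div_pos hτ), ← jacobiTheta₂_neg_left (1 / 2 / τ)]
  have e1 : Real.pi * I * (-1 / τ) / 4 = -Real.pi * I * (1 / 2) ^ 2 / τ := by ring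
  have e2 : -1 / τ / 2 = -(1 / 2 / τ) := by ring
  rw [e1, e2]
  field_simp

theorem thetaFour_neg_inv {τ : ℂ} (hτ : 0 < τ.im) :
    thetaFour (-1 / τ) = (-I * τ) ^ (1 / 2 : ℂ) * thetaTwo τ := by
  have h0 : τ ≠ 0 := by rintro rfl; simp at hτ
  have h := jacobiTheta₂_functional_equation (τ / 2) τ
  have hr := sqrt_neg_I_mul_ne_zero hτ
  rw [thetaFour_eq (im_neg_one_div_pos hτ), thetaTwo_eq hτ, h]
  have e1 : -Real.pi * I * (τ / 2) ^ 2 / τ = -(Real.pi * I * τ / 4) := by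
    field_simp; ring
  have e2 : τ / 2 / τ = 1 / 2 := by field_simp
  rw [e1, e2, exp_neg]
  have := exp_ne_zero (Real.pi * I * τ / 4)
  field_simp

theorem exp_pi_I_five_mul (τ : ℂ) : exp (Real.pi * I * (5 * τ)) = exp (Real.pi * I * τ) ^ 5 := by
  rw [← exp_nat_mul]; congr 1; push_cast; ring

theorem exp_pi_I_div_four (τ : ℂ) : exp (Real.pi * I * τ) = exp (Real.pi * I * τ / 4) ^ 4 := by
  rw [← exp_nat_mul]; congr 1; push_cast; ring

theorem thetaTwo_five_mul (τ : ℂ) :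
    thetaTwo (5 * τ) = 2 * exp (Real.pi * I * τ / 4) ^ 5 * psi (exp (Real.pi * I * τ) ^ 5) := by
  have e : exp (Real.pi * I * (5 * τ) / 4) = exp (Real.pi * I * τ / 4) ^ 5 := by
    rw [← exp_nat_mul]; congr 1; push_cast; ring
  rw [thetaTwo, exp_pi_I_five_mul, e]

/-- A relation between theta constants alone, with `phiDiff` eliminated, so that the inversion
formulas apply to it. -/
theorem thetaThree_thetaFour_quintic {τ : ℂ} (hτ : 0 < τ.im) :
    (thetaThree τ ^ 2 - thetaThree (5 * τ) ^ 2) ^ 2 * thetaThree (5 * τ) * thetaFour τ =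
      (thetaFour τ ^ 2 - thetaFour (5 * τ) ^ 2) ^ 2 * thetaFour (5 * τ) * thetaThree τ := by
  have hq := norm_exp_pi_I_lt_one hτ
  simp only [thetaThree, thetaFour, exp_pi_I_five_mul]
  rw [phi_sq_sub hq, phiNeg_sq_sub hq]
  refine mul_right_cancel₀ (euler_pow_ne_zero hq two_ne_zero) ?_
  set q := exp (Real.pi * I * τ)
  linear_combination 16 * q ^ 2 * phiNeg q * phiDiff_sq hq -
    16 * q ^ 2 * phi q * phiDiff_neg_sq hq

theorem thetaThree_thetaTwo_quintic {τ : ℂ} (hτ : 0 < τ.im) :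
    (thetaThree τ ^ 2 - thetaThree (5 * τ) ^ 2) ^ 2 * thetaThree (5 * τ) * thetaTwo τ =
      (thetaTwo τ ^ 2 - thetaTwo (5 * τ) ^ 2) ^ 2 * thetaTwo (5 * τ) * thetaThree τ := by
  have hq := norm_exp_pi_I_lt_one hτ
  have he := exp_pi_I_div_four τ
  rw [thetaTwo_five_mul]
  simp only [thetaThree, thetaTwo, exp_pi_I_five_mul]
  have h1 := phi_sq_sub hq
  have h2 := psi_sq_sub hq
  have h3 := phiDiff_sq hq
  have h4 := psiDiff_sq hq
  have h5 := euler_pow_ne_zero hq two_ne_zero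
  set q := exp (Real.pi * I * τ)
  set e := exp (Real.pi * I * τ / 4)
  have h6 : (2 * e * psi q) ^ 2 - (2 * e ^ 5 * psi (q ^ 5)) ^ 2 = 4 * e ^ 2 * psiDiff q := by
    rw [← h2, he]; ring
  rw [h1, h6]
  refine mul_right_cancel₀ h5 ?_
  have h7 : (4 * q * phiDiff q) ^ 2 = 16 * e ^ 8 * phiDiff q ^ 2 := by rw [he]; ring
  rw [h7]
  linear_combination 32 * e ^ 9 * psi q * h3 - 32 * e ^ 9 * phi q * h4

theorem sq_sqrt_neg_I_mul (τ : ℂ) : ((-I * τ) ^ (1 / 2 : ℂ)) ^ 2 = -I * τ := by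
  rw [← cpow_nat_mul]; simp

/-- The image of `thetaThree_thetaFour_quintic` under `τ ↦ -1 / (5τ)`. -/
theorem thetaThree_thetaTwo_quintic_dual {τ : ℂ} (hτ : 0 < τ.im) :
    (5 * thetaThree (5 * τ) ^ 2 - thetaThree τ ^ 2) ^ 2 * thetaThree τ * thetaTwo (5 * τ) =
      (5 * thetaTwo (5 * τ) ^ 2 - thetaTwo τ ^ 2) ^ 2 * thetaTwo τ * thetaThree (5 * τ) := by
  have h0 : τ ≠ 0 := by rintro rfl; simp at hτ
  have hτ5 : 0 < (5 * τ).im := by simpa using hτ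
  have h := thetaThree_thetaFour_quintic (im_neg_one_div_pos hτ5)
  have e : 5 * (-1 / (5 * τ)) = -1 / τ := by field_simp
  rw [e, thetaThree_neg_inv hτ, thetaThree_neg_inv hτ5, thetaFour_neg_inv hτ,
    thetaFour_neg_inv hτ5] at h
  have hr := sqrt_neg_I_mul_ne_zero hτ
  have hr5 := sqrt_neg_I_mul_ne_zero hτ5
  -- The inversion factors enter each difference only through their squares, which are in ratio 5;
  -- this is the source of the coefficient 5. The remaining common factor r⁵ r5 cancels.
  have hs : ((-I * (5 * τ)) ^ (1 / 2 : ℂ)) ^ 2 = 5 * ((-I * τ) ^ (1 / 2 : ℂ)) ^ 2 := by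
    rw [sq_sqrt_neg_I_mul, sq_sqrt_neg_I_mul]; ring
  set r := (-I * τ) ^ (1 / 2 : ℂ)
  set r5 := (-I * (5 * τ)) ^ (1 / 2 : ℂ)
  simp only [mul_pow, hs] at h
  refine mul_left_cancel₀ (mul_ne_zero (pow_ne_zero 5 hr) hr5) ?_
  linear_combination h

/-- The image of `thetaThree_thetaTwo_quintic` under `τ ↦ -1 / (5τ)`. -/
theorem thetaThree_thetaFour_quintic_dual {τ : ℂ} (hτ : 0 < τ.im) :
    (5 * thetaThree (5 * τ) ^ 2 - thetaThree τ ^ 2) ^ 2 * thetaThree τ * thetaFour (5 * τ) =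
      (5 * thetaFour (5 * τ) ^ 2 - thetaFour τ ^ 2) ^ 2 * thetaFour τ * thetaThree (5 * τ) := by
  have h0 : τ ≠ 0 := by rintro rfl; simp at hτ
  have hτ5 : 0 < (5 * τ).im := by simpa using hτ
  have h := thetaThree_thetaTwo_quintic (im_neg_one_div_pos hτ5)
  have e : 5 * (-1 / (5 * τ)) = -1 / τ := by field_simp
  rw [e, thetaThree_neg_inv hτ, thetaThree_neg_inv hτ5, thetaTwo_neg_inv hτ,
    thetaTwo_neg_inv hτ5] at h
  have hr := sqrt_neg_I_mul_ne_zero hτ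
  have hr5 := sqrt_neg_I_mul_ne_zero hτ5
  have hs : ((-I * (5 * τ)) ^ (1 / 2 : ℂ)) ^ 2 = 5 * ((-I * τ) ^ (1 / 2 : ℂ)) ^ 2 := by
    rw [sq_sqrt_neg_I_mul, sq_sqrt_neg_I_mul]; ring
  set r := (-I * τ) ^ (1 / 2 : ℂ)
  set r5 := (-I * (5 * τ)) ^ (1 / 2 : ℂ)
  simp only [mul_pow, hs] at h
  refine mul_left_cancel₀ (mul_ne_zero (pow_ne_zero 5 hr) hr5) ?_
  linear_combination h

theorem phi_phiNeg_dual {q : ℂ} (hq0 : q ≠ 0) (hq : ‖q‖ < 1) :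
    (5 * phi (q ^ 5) ^ 2 - phi q ^ 2) ^ 2 * phi q * phiNeg (q ^ 5) =
      (5 * phiNeg (q ^ 5) ^ 2 - phiNeg q ^ 2) ^ 2 * phiNeg q * phi (q ^ 5) := by
  obtain ⟨τ, hτ, rfl⟩ := exists_exp_pi_I hq0 hq
  have h := thetaThree_thetaFour_quintic_dual hτ
  simpa only [thetaThree, thetaFour, exp_pi_I_five_mul] using h

theorem phi_psi_dual {q : ℂ} (hq0 : q ≠ 0) (hq : ‖q‖ < 1) :
    (5 * phi (q ^ 5) ^ 2 - phi q ^ 2) ^ 2 * phi q * psi (q ^ 5) =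
      16 * (5 * q ^ 2 * psi (q ^ 5) ^ 2 - psi q ^ 2) ^ 2 * psi q * phi (q ^ 5) := by
  obtain ⟨τ, hτ, rfl⟩ := exists_exp_pi_I hq0 hq
  have h := thetaThree_thetaTwo_quintic_dual hτ
  rw [thetaTwo_five_mul] at h
  simp only [thetaThree, thetaTwo, exp_pi_I_five_mul] at h
  have he := exp_pi_I_div_four τ
  have hn := exp_ne_zero (Real.pi * I * τ / 4)
  set q := exp (Real.pi * I * τ)
  set e := exp (Real.pi * I * τ / 4)
  have h1 : (5 * (2 * e ^ 5 * psi (q ^ 5)) ^ 2 - (2 * e * psi q) ^ 2) ^ 2 =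
      16 * e ^ 4 * (5 * q ^ 2 * psi (q ^ 5) ^ 2 - psi q ^ 2) ^ 2 := by
    rw [he]; ring
  rw [h1] at h
  refine mul_left_cancel₀ (pow_ne_zero 5 hn) ?_
  linear_combination h / 2

/-! ### The cubic equation and the identities of level twenty. -/

/-- The hypotheses say that m, n and -l are roots of t³ - x t² - 5t + x, and they are distinct, so
their sum is x and their product -x. -/
theorem vieta_of_cubic {l m n x : ℂ} (hl : l * (5 - l ^ 2) = x * (l ^ 2 - 1))
    (hm : m * (5 - m ^ 2) = -x * (m ^ 2 - 1)) (hn : n * (5 - n ^ 2) = -x * (n ^ 2 - 1))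
    (hmn : m - n ≠ 0) (hml : m + l ≠ 0) (hnl : n + l ≠ 0) : m + n - l = x ∧ l * m * n = x := by
  have h1 : m ^ 2 + m * n + n ^ 2 - x * (m + n) - 5 = 0 := by
    refine mul_left_cancel₀ hmn ?_
    linear_combination -hm + hn
  have h2 : m ^ 2 - m * l + l ^ 2 - x * (m - l) - 5 = 0 := by
    refine mul_left_cancel₀ hml ?_
    linear_combination -hm - hl
  have h3 : m + n - l = x := by
    refine mul_left_cancel₀ hnl ?_
    linear_combination h1 - h2
  refine ⟨h3, ?_⟩
  linear_combination m * h1 + hm - m * n * h3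

theorem differentiableOn_ball {f : ℂ → ℂ} (hf : ∀ q, ‖q‖ < 1 → DifferentiableAt ℂ f q) :
    DifferentiableOn ℂ f (Metric.ball 0 1) := fun q hq ↦
  (hf q (by simpa using hq)).differentiableWithinAt

/-- The identity theorem: relations may be proved only near q = 0, where limits settle signs and
nonvanishing. -/
theorem eq_of_eventually_eq {f g : ℂ → ℂ} (hf : DifferentiableOn ℂ f (Metric.ball 0 1))
    (hg : DifferentiableOn ℂ g (Metric.ball 0 1)) (h : ∀ᶠ q in 𝓝[≠] 0, f q = g q) {q : ℂ}
    (hq : ‖q‖ < 1) : f q = g q :=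
  (hf.analyticOnNhd Metric.isOpen_ball).eqOn_of_preconnected_of_frequently_eq
    (hg.analyticOnNhd Metric.isOpen_ball) (convex_ball 0 1).isPreconnected
    (Metric.mem_ball_self one_pos) h.frequently (by simpa using hq)

theorem DifferentiableAt.comp_pow {f : ℂ → ℂ} (hf : ∀ q, ‖q‖ < 1 → DifferentiableAt ℂ f q)
    {k : ℕ} (hk : k ≠ 0) (q : ℂ) (hq : ‖q‖ < 1) : DifferentiableAt ℂ (fun x ↦ f (x ^ k)) q :=
  (hf _ (norm_pow_lt_one hq hk)).comp q (differentiableAt_pow k)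

theorem differentiableAt_phiDiff {q : ℂ} (hq : ‖q‖ < 1) : DifferentiableAt ℂ phiDiff q :=
  ((((differentiableAt_euler_pow hq two_ne_zero).pow 2).mul
    (differentiableAt_euler_pow hq (by norm_num))).mul
    (differentiableAt_euler_pow hq (by norm_num))).fun_div
    ((differentiableAt_euler hq).mul (differentiableAt_euler_pow hq four_ne_zero))
    (mul_ne_zero (euler_ne_zero hq) (euler_pow_ne_zero hq four_ne_zero))

theorem differentiableAt_psiDiff {q : ℂ} (hq : ‖q‖ < 1) : DifferentiableAt ℂ psiDiff q :=
  (((differentiableAt_euler_pow hq (by norm_num)).pow 3).mul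
    (differentiableAt_euler_pow hq four_ne_zero)).fun_div
    ((differentiableAt_euler_pow hq two_ne_zero).mul
      (differentiableAt_euler_pow hq (by norm_num)))
    (mul_ne_zero (euler_pow_ne_zero hq two_ne_zero) (euler_pow_ne_zero hq (by norm_num)))

theorem phiDiff_ne_zero {q : ℂ} (hq : ‖q‖ < 1) : phiDiff q ≠ 0 :=
  div_ne_zero (mul_ne_zero (mul_ne_zero (pow_ne_zero _ (euler_pow_ne_zero hq two_ne_zero))
    (euler_pow_ne_zero hq (by norm_num))) (euler_pow_ne_zero hq (by norm_num)))
    (mul_ne_zero (euler_ne_zero hq) (euler_pow_ne_zero hq four_ne_zero))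

theorem psiDiff_ne_zero {q : ℂ} (hq : ‖q‖ < 1) : psiDiff q ≠ 0 :=
  div_ne_zero (mul_ne_zero (pow_ne_zero _ (euler_pow_ne_zero hq (by norm_num)))
    (euler_pow_ne_zero hq four_ne_zero))
    (mul_ne_zero (euler_pow_ne_zero hq two_ne_zero) (euler_pow_ne_zero hq (by norm_num)))

theorem phiDiff_zero : phiDiff 0 = 1 := by simp [phiDiff, euler_zero]

theorem psiDiff_zero : psiDiff 0 = 1 := by simp [psiDiff, euler_zero]

/-- Jacobi's θ₂θ₃θ₄ = 2η³, without the fractional power of q. -/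
theorem phi_mul_phiNeg_mul_psi {q : ℂ} (hq : ‖q‖ < 1) :
    phi q * phiNeg q * psi q = euler (q ^ 2) ^ 3 := by
  have h1 := euler_ne_zero hq
  have h2 := euler_pow_ne_zero hq two_ne_zero
  have h4 := euler_pow_ne_zero hq four_ne_zero
  simp only [phi, phiNeg, psi]
  field_simp

/-- Two functions with equal squares and the same nonzero limit agree eventually. -/
theorem eventually_eq_of_sq_eq {f g : ℂ → ℂ} {c : ℂ} (hc : c ≠ 0) (hf : Tendsto f (𝓝[≠] 0) (𝓝 c))
    (hg : Tendsto g (𝓝[≠] 0) (𝓝 c)) (h : ∀ᶠ q in 𝓝[≠] 0, f q ^ 2 = g q ^ 2) :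
    ∀ᶠ q in 𝓝[≠] 0, f q = g q := by
  have h1 : ∀ᶠ q in 𝓝[≠] 0, f q + g q ≠ 0 :=
    (hf.add hg).eventually_ne (by rw [← two_mul]; exact mul_ne_zero two_ne_zero hc)
  filter_upwards [h, h1] with q e1 e2
  refine sub_eq_zero.mp ((mul_eq_zero.mp ?_).resolve_right e2)
  linear_combination e1

theorem eventually_mem_punctured_ball : ∀ᶠ q : ℂ in 𝓝[≠] 0, q ≠ 0 ∧ ‖q‖ < 1 :=
  (eventually_mem_nhdsWithin.mono fun _ h ↦ h).and
    (eventually_nhdsWithin_of_eventually_nhds (eventually_norm_lt_one (by simp)))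

/-- The identities between theta functions of `q` and `q⁵` that come from the cubic equation
satisfied by the quotients `φ(q)/φ(q⁵)`, `φ(-q)/φ(-q⁵)` and `ψ(q²)/(qψ(q¹⁰))`. -/
theorem eventually_vieta : ∀ᶠ q : ℂ in 𝓝[≠] 0,
    phi q / phi (q ^ 5) * (phiNeg q / phiNeg (q ^ 5)) * (psi q / (q * psi (q ^ 5))) =
      phi q * (5 * phi (q ^ 5) ^ 2 - phi q ^ 2) / (phi (q ^ 5) * phiDiff q) / (4 * q) ∧
    phiNeg q / phiNeg (q ^ 5) + psi q / (q * psi (q ^ 5)) - phi q / phi (q ^ 5) =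
      phi q * (5 * phi (q ^ 5) ^ 2 - phi q ^ 2) / (phi (q ^ 5) * phiDiff q) / (4 * q) := by
  have z1 : ‖(0 : ℂ)‖ < 1 := by simp
  have five : (5 : ℕ) ≠ 0 := by norm_num
  have ca : ContinuousAt phi 0 := (differentiableAt_phi z1).continuousAt
  have cb : ContinuousAt phiNeg 0 := (differentiableAt_phiNeg z1).continuousAt
  have cp : ContinuousAt psi 0 := (differentiableAt_psi z1).continuousAt
  have cA : ContinuousAt (fun q ↦ phi (q ^ 5)) 0 :=
    (DifferentiableAt.comp_pow (fun _ ↦ differentiableAt_phi) five 0 z1).continuousAt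
  have cB : ContinuousAt (fun q ↦ phiNeg (q ^ 5)) 0 :=
    (DifferentiableAt.comp_pow (fun _ ↦ differentiableAt_phiNeg) five 0 z1).continuousAt
  have cP : ContinuousAt (fun q ↦ psi (q ^ 5)) 0 :=
    (DifferentiableAt.comp_pow (fun _ ↦ differentiableAt_psi) five 0 z1).continuousAt
  have cF : ContinuousAt phiDiff 0 := (differentiableAt_phiDiff z1).continuousAt
  have cF' : ContinuousAt (fun q ↦ phiDiff (-q)) 0 :=
    ContinuousAt.comp (g := phiDiff) (f := fun q : ℂ ↦ -q) (x := 0) (by simpa using cF) continuous_neg.continuousAt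
  have cH : ContinuousAt psiDiff 0 := (differentiableAt_psiDiff z1).continuousAt
  have cq : ContinuousAt (fun q : ℂ ↦ q) 0 := continuousAt_id
  let xa : ℂ → ℂ := fun q ↦
    phi q * (5 * phi (q ^ 5) ^ 2 - phi q ^ 2) / (phi (q ^ 5) * phiDiff q)
  let xb : ℂ → ℂ := fun q ↦
    phiNeg q * (5 * phiNeg (q ^ 5) ^ 2 - phiNeg q ^ 2) / (phiNeg (q ^ 5) * phiDiff (-q))
  let xc : ℂ → ℂ := fun q ↦
    4 * psi q * (psi q ^ 2 - 5 * q ^ 2 * psi (q ^ 5) ^ 2) / (psi (q ^ 5) * psiDiff q)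
  have la : Tendsto xa (𝓝[≠] 0) (𝓝 4) := by
    have : ContinuousAt xa 0 := (ca.mul ((continuousAt_const.mul (cA.pow 2)).sub (ca.pow 2))).div
      (cA.mul cF) (by simp [phi_zero, phiDiff_zero])
    convert this.tendsto.mono_left nhdsWithin_le_nhds using 2
    simp [xa, phi_zero, phiDiff_zero]; norm_num
  have lb : Tendsto xb (𝓝[≠] 0) (𝓝 4) := by
    have : ContinuousAt xb 0 := (cb.mul ((continuousAt_const.mul (cB.pow 2)).sub (cb.pow 2))).div
      (cB.mul cF') (by simp [phiNeg_zero, phiDiff_zero])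
    convert this.tendsto.mono_left nhdsWithin_le_nhds using 2
    simp [xb, phiNeg_zero, phiDiff_zero]; norm_num
  have lc : Tendsto xc (𝓝[≠] 0) (𝓝 4) := by
    have : ContinuousAt xc 0 := ((continuousAt_const.mul cp).mul ((cp.pow 2).sub
      ((continuousAt_const.mul (cq.pow 2)).mul (cP.pow 2)))).div
      (cP.mul cH) (by simp [psi_zero, psiDiff_zero])
    convert this.tendsto.mono_left nhdsWithin_le_nhds using 2
    simp [xc, psi_zero, psiDiff_zero]
  -- The dual relations and the common value f₁₀⁵/f₂ determine `xa`, `xb`, `xc` only up to sign. All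
  -- three tend to 4 at 0, so they coincide nearby and the three cubics have the same x.
  have hab := eventually_eq_of_sq_eq (by norm_num : (4 : ℂ) ≠ 0) la lb (by
    filter_upwards [eventually_mem_punctured_ball] with q ⟨hq0, hq⟩
    have hq5 := norm_pow_lt_one hq five
    have d := phi_phiNeg_dual hq0 hq
    have k : phiDiff q ^ 2 * phi (q ^ 5) * phiNeg q =
        phiDiff (-q) ^ 2 * phiNeg (q ^ 5) * phi q := by
      refine mul_right_cancel₀ (euler_pow_ne_zero hq two_ne_zero) ?_
      linear_combination phiNeg q * phiDiff_sq hq - phi q * phiDiff_neg_sq hq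
    have n1 := phi_ne_zero hq5
    have n2 := phiNeg_ne_zero hq5
    have n3 := phiDiff_ne_zero hq
    have n4 := phiDiff_ne_zero (q := -q) (by rwa [norm_neg])
    simp only [xa, xb]
    rw [div_pow, div_pow, div_eq_div_iff (pow_ne_zero _ (mul_ne_zero n1 n3))
      (pow_ne_zero _ (mul_ne_zero n2 n4))]
    linear_combination phi q * phiNeg (q ^ 5) * phiDiff (-q) ^ 2 * d -
      (5 * phiNeg (q ^ 5) ^ 2 - phiNeg q ^ 2) ^ 2 * phiNeg q * phi (q ^ 5) * k)
  have hac := eventually_eq_of_sq_eq (by norm_num : (4 : ℂ) ≠ 0) la lc (by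
    filter_upwards [eventually_mem_punctured_ball] with q ⟨hq0, hq⟩
    have hq5 := norm_pow_lt_one hq five
    have d := phi_psi_dual hq0 hq
    have k : phiDiff q ^ 2 * phi (q ^ 5) * psi q =
        psiDiff q ^ 2 * psi (q ^ 5) * phi q := by
      refine mul_right_cancel₀ (euler_pow_ne_zero hq two_ne_zero) ?_
      linear_combination psi q * phiDiff_sq hq - phi q * psiDiff_sq hq
    have n1 := phi_ne_zero hq5
    have n2 := psi_ne_zero hq5
    have n3 := phiDiff_ne_zero hq
    have n4 := psiDiff_ne_zero hq
    simp only [xa, xc]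
    rw [div_pow, div_pow, div_eq_div_iff (pow_ne_zero _ (mul_ne_zero n1 n3))
      (pow_ne_zero _ (mul_ne_zero n2 n4))]
    linear_combination phi q * psi (q ^ 5) * psiDiff q ^ 2 * d -
      16 * (5 * q ^ 2 * psi (q ^ 5) ^ 2 - psi q ^ 2) ^ 2 * psi q * phi (q ^ 5) * k)
  -- Distinctness of the three roots, with denominators cleared; the limits at 0 are -1, 2 and 1.
  have d1 : ∀ᶠ q in 𝓝[≠] 0, phiNeg q * (q * psi (q ^ 5)) - psi q * phiNeg (q ^ 5) ≠ 0 := by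
    refine ((((cb.mul (cq.mul cP)).sub (cp.mul cB)).tendsto).mono_left
      nhdsWithin_le_nhds).eventually_ne ?_
    simp [phiNeg_zero, psi_zero]
  have d2 : ∀ᶠ q in 𝓝[≠] 0, phiNeg q * phi (q ^ 5) + phi q * phiNeg (q ^ 5) ≠ 0 := by
    refine ((((cb.mul cA).add (ca.mul cB)).tendsto).mono_left
      nhdsWithin_le_nhds).eventually_ne ?_
    simp [phiNeg_zero, phi_zero]
  have d3 : ∀ᶠ q in 𝓝[≠] 0, psi q * phi (q ^ 5) + phi q * (q * psi (q ^ 5)) ≠ 0 := by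
    refine ((((cp.mul cA).add (ca.mul (cq.mul cP))).tendsto).mono_left
      nhdsWithin_le_nhds).eventually_ne ?_
    simp [psi_zero, phi_zero]
  filter_upwards [eventually_mem_punctured_ball, hab, hac, d1, d2, d3] with
    q ⟨hq0, hq⟩ hab hac d1 d2 d3
  have hq5 := norm_pow_lt_one hq five
  have n1 := phi_ne_zero hq5
  have n2 := phiNeg_ne_zero hq5
  have n3 := psi_ne_zero hq5
  have m1 := phiDiff_ne_zero hq
  have m2 := phiDiff_ne_zero (q := -q) (by rwa [norm_neg])
  have m3 := psiDiff_ne_zero hq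
  have s1 := phi_sq_sub hq
  have s2 := phiNeg_sq_sub hq
  have s3 := psi_sq_sub hq
  refine (vieta_of_cubic (x := xa q / (4 * q)) ?_ ?_ ?_ ?_ ?_ ?_).symm
  · simp only [xa]
    field_simp
    linear_combination (-(phi q * (5 * phi (q ^ 5) ^ 2 - phi q ^ 2))) * s1
  · rw [hab]
    simp only [xb]
    field_simp
    linear_combination (phiNeg q * (5 * phiNeg (q ^ 5) ^ 2 - phiNeg q ^ 2)) * s2
  · rw [hac]
    simp only [xc]
    field_simp
    linear_combination (psi q * (psi q ^ 2 - 5 * q ^ 2 * psi (q ^ 5) ^ 2)) * s3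
  · rw [div_sub_div _ _ n2 (mul_ne_zero hq0 n3)]
    exact div_ne_zero (by rwa [mul_comm (phiNeg (q ^ 5))]) (mul_ne_zero n2 (mul_ne_zero hq0 n3))
  · rw [div_add_div _ _ n2 n1]
    exact div_ne_zero (by rwa [mul_comm (phiNeg (q ^ 5))]) (mul_ne_zero n2 n1)
  · rw [div_add_div _ _ (mul_ne_zero hq0 n3) n1]
    exact div_ne_zero (by rwa [mul_comm (q * psi (q ^ 5))]) (mul_ne_zero (mul_ne_zero hq0 n3) n1)

/-- `16 q f₂² f₁₀² = (φ(q)² - φ(q⁵)²)(5 φ(q⁵)² - φ(q)²)`, where `f_k = euler (q ^ k)`, divided by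
`4 q`. -/
theorem phiDiff_mul_dual {q : ℂ} (hq : ‖q‖ < 1) :
    4 * euler (q ^ 2) ^ 2 * euler (q ^ 10) ^ 2 =
      phiDiff q * (5 * phi (q ^ 5) ^ 2 - phi q ^ 2) := by
  refine eq_of_eventually_eq (f := fun q ↦ 4 * euler (q ^ 2) ^ 2 * euler (q ^ 10) ^ 2)
    (g := fun q ↦ phiDiff q * (5 * phi (q ^ 5) ^ 2 - phi q ^ 2)) ?_ ?_ ?_ hq
  · refine differentiableOn_ball fun q hq ↦ ?_
    exact (((differentiableAt_euler_pow hq two_ne_zero).pow 2).const_mul 4).mul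
      ((differentiableAt_euler_pow hq (by norm_num)).pow 2)
  · refine differentiableOn_ball fun q hq ↦ ?_
    exact (differentiableAt_phiDiff hq).mul
      ((((DifferentiableAt.comp_pow (fun _ ↦ differentiableAt_phi) (by norm_num) q hq).pow
        2).const_mul 5).sub ((differentiableAt_phi hq).pow 2))
  · filter_upwards [eventually_mem_punctured_ball, eventually_vieta] with q ⟨hq0, hq⟩ ⟨h, _⟩
    have hq5 := norm_pow_lt_one hq (by norm_num : 5 ≠ 0)
    have n1 := phi_ne_zero hq5
    have n2 := phiNeg_ne_zero hq5
    have n3 := psi_ne_zero hq5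
    have m0 := phi_ne_zero hq
    have m1 := phiDiff_ne_zero hq
    have h2 := euler_pow_ne_zero hq two_ne_zero
    have h10 := euler_pow_ne_zero hq (by norm_num : 10 ≠ 0)
    have p1 := phi_mul_phiNeg_mul_psi hq
    have p2 := phi_mul_phiNeg_mul_psi hq5
    rw [← pow_mul] at p2
    norm_num at p2
    have s := phiDiff_sq hq
    -- The product of the roots, simplified by θ₂θ₃θ₄ = 2η³ at q and at q⁵.
    have h' : 4 * euler (q ^ 2) ^ 3 * phi (q ^ 5) * phiDiff q =
        euler (q ^ 10) ^ 3 * phi q * (5 * phi (q ^ 5) ^ 2 - phi q ^ 2) := by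
      rw [← p1, ← p2]
      rw [show phi q / phi (q ^ 5) * (phiNeg q / phiNeg (q ^ 5)) * (psi q / (q * psi (q ^ 5))) =
        phi q * phiNeg q * psi q / (q * (phi (q ^ 5) * phiNeg (q ^ 5) * psi (q ^ 5))) by
          field_simp, div_div, div_eq_div_iff
          (mul_ne_zero hq0 (mul_ne_zero (mul_ne_zero n1 n2) n3))
          (mul_ne_zero (mul_ne_zero n1 m1) (mul_ne_zero (by norm_num) hq0))] at h
      refine mul_left_cancel₀ hq0 ?_
      linear_combination h
    refine mul_left_cancel₀ (mul_ne_zero (pow_ne_zero 3 h10) m0) ?_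
    linear_combination phiDiff q * h' - 4 * euler (q ^ 2) ^ 2 * s

/-- The sum of the roots gives b/B + p/(qP) = x + a/A, and a² - A² = 4q `phiDiff q` reduces the
right side to aA/(q `phiDiff q`). -/
theorem eventually_sum_mul_phiDiff : ∀ᶠ q : ℂ in 𝓝[≠] 0,
    (psi q * phiNeg (q ^ 5) + q * phiNeg q * psi (q ^ 5)) * phiDiff q =
      phi q * phi (q ^ 5) * phiNeg (q ^ 5) * psi (q ^ 5) := by
  filter_upwards [eventually_mem_punctured_ball, eventually_vieta] with q ⟨hq0, hq⟩ ⟨_, h⟩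
  have hq5 := norm_pow_lt_one hq (by norm_num : 5 ≠ 0)
  have n1 := phi_ne_zero hq5
  have n2 := phiNeg_ne_zero hq5
  have n3 := psi_ne_zero hq5
  have m1 := phiDiff_ne_zero hq
  have s1 := phi_sq_sub hq
  have h' : phiNeg q / phiNeg (q ^ 5) + psi q / (q * psi (q ^ 5)) =
      phi q * phi (q ^ 5) / (q * phiDiff q) := by
    rw [sub_eq_iff_eq_add.mp h]
    field_simp
    linear_combination -phi q * s1
  field_simp at h'
  linear_combination h'

/-- `Z u = z (1 + u)²`, in terms of theta functions. -/
theorem phi_mul_sq {q : ℂ} (hq : ‖q‖ < 1) :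
    phi q ^ 2 * phi (q ^ 5) ^ 2 * (phiNeg q * psi (q ^ 5) * psi q * phiNeg (q ^ 5)) =
      euler (q ^ 2) ^ 2 * euler (q ^ 10) ^ 2 *
        (psi q * phiNeg (q ^ 5) + q * phiNeg q * psi (q ^ 5)) ^ 2 := by
  have da := differentiableOn_ball fun _ ↦ differentiableAt_phi
  have db := differentiableOn_ball fun _ ↦ differentiableAt_phiNeg
  have dp := differentiableOn_ball fun _ ↦ differentiableAt_psi
  have five : (5 : ℕ) ≠ 0 := by norm_num
  have dA := differentiableOn_ball (DifferentiableAt.comp_pow (fun _ ↦ differentiableAt_phi) five)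
  have dB := differentiableOn_ball
    (DifferentiableAt.comp_pow (fun _ ↦ differentiableAt_phiNeg) five)
  have dP := differentiableOn_ball (DifferentiableAt.comp_pow (fun _ ↦ differentiableAt_psi) five)
  have dF := differentiableOn_ball fun _ ↦ differentiableAt_phiDiff
  have h (q : ℂ) (hq : ‖q‖ < 1) := eq_of_eventually_eq (((dp.mul dB).add
    ((differentiableOn_id.mul db).mul dP)).mul dF) (((da.mul dA).mul dB).mul dP)
    eventually_sum_mul_phiDiff hq
  have h := h q hq
  simp only [Pi.mul_apply, Pi.add_apply] at h
  have hq5 := norm_pow_lt_one hq five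
  have n1 := phi_ne_zero hq5
  have m0 := phi_ne_zero hq
  have m1 := phiDiff_ne_zero hq
  have h2 := euler_pow_ne_zero hq two_ne_zero
  have p1 := phi_mul_phiNeg_mul_psi hq
  have p2 := phi_mul_phiNeg_mul_psi hq5
  rw [← pow_mul] at p2
  norm_num at p2
  have s := phiDiff_sq hq
  -- Removes `phiDiff` from the square of the preceding relation.
  have k : euler (q ^ 2) ^ 2 * euler (q ^ 10) ^ 2 * phiNeg (q ^ 5) * psi (q ^ 5) =
      phiNeg q * psi q * phiDiff q ^ 2 := by
    refine mul_left_cancel₀ (mul_ne_zero (mul_ne_zero n1 h2) m0) ?_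
    linear_combination euler (q ^ 2) ^ 3 * euler (q ^ 10) ^ 2 * phi q * p2 -
      phi q * phiNeg q * psi q * s - euler (q ^ 10) ^ 5 * phi q * p1
  refine mul_left_cancel₀ (pow_ne_zero 2 m1) ?_
  set T := psi q * phiNeg (q ^ 5) + q * phiNeg q * psi (q ^ 5)
  linear_combination (-(euler (q ^ 2) ^ 2 * euler (q ^ 10) ^ 2) *
    (T * phiDiff q + phi q * phi (q ^ 5) * phiNeg (q ^ 5) * psi (q ^ 5))) * h -
    phi q ^ 2 * phi (q ^ 5) ^ 2 * phiNeg (q ^ 5) * psi (q ^ 5) * k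

/-! ### Uniqueness of the branch, and the functions u, z, Z in terms of theta functions. -/

theorem IsSqrtBranch.unique {f S T : ℂ → ℂ} (hS : IsSqrtBranch f S) (hT : IsSqrtBranch f T)
    {q : ℂ} (hq : ‖q‖ < 1) : S q = T q := by
  have lim {R : ℂ → ℂ} (hR : IsSqrtBranch f R) : Tendsto R (𝓝[≠] 0) (𝓝 1) := by
    have := (hR.differentiableOn.differentiableAt (Metric.ball_mem_nhds 0 one_pos)).continuousAt
    rw [← hR.map_zero]
    exact this.tendsto.mono_left nhdsWithin_le_nhds
  refine eq_of_eventually_eq hS.differentiableOn hT.differentiableOn ?_ hq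
  refine eventually_eq_of_sq_eq one_ne_zero (lim hS) (lim hT) ?_
  filter_upwards [eventually_mem_punctured_ball] with x ⟨hx0, hx⟩
  rw [hS.sq_eq x (norm_pos_iff.mpr hx0) hx, hT.sq_eq x (norm_pos_iff.mpr hx0) hx]

theorem etaDil_eq (l : ℕ) (τ : ℂ) :
    etaDil l τ = exp (2 * Real.pi * I * τ / 24) ^ l * euler (exp (2 * Real.pi * I * τ) ^ l) := by
  rw [etaDil, ModularForm.eta, euler]
  congr 1
  · rw [Function.Periodic.qParam, ← exp_nat_mul]
    congr 1; push_cast; ring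
  · refine tprod_congr fun n ↦ ?_
    rw [ModularForm.eta_q_eq_pow, ← exp_nat_mul (2 * Real.pi * I * τ)]
    congr 3; ring

theorem exp_div_pow (τ : ℂ) :
    exp (2 * Real.pi * I * τ) = exp (2 * Real.pi * I * τ / 24) ^ 24 := by
  rw [← exp_nat_mul]; congr 1; push_cast; ring

theorem exists_exp_two_pi_I {q : ℂ} (hq0 : q ≠ 0) : ∃ τ : ℂ, exp (2 * Real.pi * I * τ) = q := by
  refine ⟨log q / (2 * Real.pi * I), ?_⟩
  rw [mul_div_cancel₀ _ two_pi_I_ne_zero, exp_log hq0]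

theorem z_eq {q : ℂ} (hq0 : q ≠ 0) : z q = q * euler (q ^ 2) ^ 2 * euler (q ^ 10) ^ 2 := by
  obtain ⟨τ, rfl⟩ := exists_exp_two_pi_I hq0
  rw [z_qParam, zTau, etaDil_eq, etaDil_eq]
  -- The exponents of q^(1/24) add up to 2·2 + 2·10 = 24, which leaves the single factor q.
  linear_combination (-(euler (exp (2 * Real.pi * I * τ) ^ 2) ^ 2 *
    euler (exp (2 * Real.pi * I * τ) ^ 10) ^ 2)) * exp_div_pow τ

/-- The extension of `u` to the unit disc, in terms of theta functions. -/
def uDisc (q : ℂ) : ℂ := q * phiNeg q * psi (q ^ 5) / (psi q * phiNeg (q ^ 5))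

theorem u_eq {q : ℂ} (hq0 : q ≠ 0) (hq : ‖q‖ < 1) : u q = uDisc q := by
  have h1 := euler_ne_zero hq
  have h2 := euler_pow_ne_zero hq two_ne_zero
  have h4 := euler_pow_ne_zero hq four_ne_zero
  have h5 := euler_pow_ne_zero hq (by norm_num : 5 ≠ 0)
  have h10 := euler_pow_ne_zero hq (by norm_num : 10 ≠ 0)
  have h20 := euler_pow_ne_zero hq (by norm_num : 20 ≠ 0)
  have h : uDisc q = q * (euler q * euler (q ^ 20) / (euler (q ^ 4) * euler (q ^ 5))) ^ 2 := by
    simp only [uDisc, phiNeg, psi, ← pow_mul]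
    norm_num
    field_simp
  rw [h]
  clear h h1 h2 h4 h5 h10 h20 hq
  obtain ⟨τ, rfl⟩ := exists_exp_two_pi_I hq0
  rw [u_qParam, uTau]
  simp only [etaDil_eq, pow_one]
  have he := exp_div_pow τ
  have hn := exp_ne_zero (2 * Real.pi * I * τ / 24)
  set q := exp (2 * Real.pi * I * τ)
  set e := exp (2 * Real.pi * I * τ / 24)
  have : e * euler q * (e ^ 20 * euler (q ^ 20)) / (e ^ 4 * euler (q ^ 4) * (e ^ 5 * euler (q ^ 5)))
      = e ^ 12 * (euler q * euler (q ^ 20) / (euler (q ^ 4) * euler (q ^ 5))) := by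
    rw [show e * euler q * (e ^ 20 * euler (q ^ 20)) =
        e ^ 9 * (e ^ 12 * (euler q * euler (q ^ 20))) by ring,
      show e ^ 4 * euler (q ^ 4) * (e ^ 5 * euler (q ^ 5)) =
        e ^ 9 * (euler (q ^ 4) * euler (q ^ 5)) by ring,
      mul_div_mul_left _ _ (pow_ne_zero 9 hn), mul_div_assoc]
  rw [this, mul_pow, ← pow_mul, ← he]

theorem Z_eq {q : ℂ} (hq0 : q ≠ 0) (hq : ‖q‖ < 1) : Z q = phi q ^ 2 * phi (q ^ 5) ^ 2 := by
  have h : ∑' m : ℤ, ∑' n : ℤ, q ^ (m ^ 2 + 5 * n ^ 2) = phi q * phi (q ^ 5) := by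
    rw [← phi_eq_tsum hq0 hq, ← phi_eq_tsum (pow_ne_zero 5 hq0) (norm_pow_lt_one hq (by norm_num)),
      ← tsum_mul_right]
    refine tsum_congr fun m ↦ ?_
    rw [← tsum_mul_left]
    refine tsum_congr fun n ↦ ?_
    rw [zpow_add₀ hq0, zpow_mul]
    norm_cast
  rw [Z, h, mul_pow]

theorem uDisc_zero : uDisc 0 = 0 := by simp [uDisc]

theorem uDisc_ne_zero {q : ℂ} (hq0 : q ≠ 0) (hq : ‖q‖ < 1) : uDisc q ≠ 0 := by
  have hq5 := norm_pow_lt_one hq (by norm_num : 5 ≠ 0)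
  exact div_ne_zero (mul_ne_zero (mul_ne_zero hq0 (phiNeg_ne_zero hq)) (psi_ne_zero hq5))
    (mul_ne_zero (psi_ne_zero hq) (phiNeg_ne_zero hq5))

theorem differentiableAt_uDisc {q : ℂ} (hq : ‖q‖ < 1) : DifferentiableAt ℂ uDisc q := by
  have five : (5 : ℕ) ≠ 0 := by norm_num
  exact ((differentiableAt_id.mul (differentiableAt_phiNeg hq)).mul
    (DifferentiableAt.comp_pow (fun _ ↦ differentiableAt_psi) five q hq)).fun_div
    ((differentiableAt_psi hq).mul
      (DifferentiableAt.comp_pow (fun _ ↦ differentiableAt_phiNeg) five q hq))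
    (mul_ne_zero (psi_ne_zero hq) (phiNeg_ne_zero (norm_pow_lt_one hq five)))

/-- A zero of 1 + u would make the right side of `phi_mul_sq` vanish, while its left side is a
product of nonvanishing theta functions. -/
theorem one_add_uDisc_ne_zero {q : ℂ} (hq : ‖q‖ < 1) : 1 + uDisc q ≠ 0 := by
  have hq5 := norm_pow_lt_one hq (by norm_num : 5 ≠ 0)
  have n1 := psi_ne_zero hq
  have n2 := phiNeg_ne_zero hq5
  have e : 1 + uDisc q = (psi q * phiNeg (q ^ 5) + q * phiNeg q * psi (q ^ 5)) /
      (psi q * phiNeg (q ^ 5)) := by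
    rw [uDisc, add_div, div_self (mul_ne_zero n1 n2)]
  rw [e]
  refine div_ne_zero (fun h ↦ ?_) (mul_ne_zero n1 n2)
  have := phi_mul_sq hq
  rw [h, zero_pow two_ne_zero, mul_zero] at this
  exact mul_ne_zero (mul_ne_zero (pow_ne_zero 2 (phi_ne_zero hq)) (pow_ne_zero 2 (phi_ne_zero hq5)))
    (mul_ne_zero (mul_ne_zero (mul_ne_zero (phiNeg_ne_zero hq) (psi_ne_zero hq5)) n1) n2) this

/-! ### The differential equations and the square-root branches. -/

/-- The weight two Eisenstein series `(5 φ(q⁵)⁴ - φ(q)⁴) / 4`. -/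
def eisen (q : ℂ) : ℂ := (5 * phi (q ^ 5) ^ 4 - phi q ^ 4) / 4

theorem eisen_zero : eisen 0 = 1 := by simp [eisen, phi_zero]; norm_num

theorem differentiableAt_eisen {q : ℂ} (hq : ‖q‖ < 1) : DifferentiableAt ℂ eisen q :=
  ((((DifferentiableAt.comp_pow (fun _ ↦ differentiableAt_phi) (by norm_num) q hq).pow
    4).const_mul 5).sub ((differentiableAt_phi hq).pow 4)).div_const 4

theorem Z_mul_uDisc {q : ℂ} (hq0 : q ≠ 0) (hq : ‖q‖ < 1) :
    Z q * uDisc q = z q * (1 + uDisc q) ^ 2 := by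
  have n1 := psi_ne_zero hq
  have n2 := phiNeg_ne_zero (norm_pow_lt_one hq (by norm_num : 5 ≠ 0))
  have h := phi_mul_sq hq
  rw [Z_eq hq0 hq, z_eq hq0, uDisc]
  field_simp
  linear_combination h

theorem eisen_sq {q : ℂ} (hq0 : q ≠ 0) (hq : ‖q‖ < 1) :
    eisen q ^ 2 = Z q ^ 2 - 12 * Z q * z q + 16 * z q ^ 2 := by
  have h1 := phiDiff_mul_dual hq
  have h2 := phi_sq_sub hq
  -- In terms of a² and A², both z and Z become polynomials, and the claim is a polynomial identity.
  have hz : 16 * z q =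
      (phi q ^ 2 - phi (q ^ 5) ^ 2) * (5 * phi (q ^ 5) ^ 2 - phi q ^ 2) := by
    rw [z_eq hq0, h2]
    linear_combination 4 * q * h1
  have hz' := eq_div_of_mul_eq (by norm_num) ((mul_comm _ _).trans hz)
  rw [Z_eq hq0 hq, hz', eisen]
  ring

theorem logDeriv_comp_pow {f : ℂ → ℂ} (hf : ∀ q, ‖q‖ < 1 → DifferentiableAt ℂ f q) {k : ℕ}
    (hk : k ≠ 0) {q : ℂ} (hq : ‖q‖ < 1) :
    thetaLog (fun x ↦ f (x ^ k)) q = k * thetaLog f (q ^ k) := by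
  have h := logDeriv_comp (f := f) (g := fun x : ℂ ↦ x ^ k) (x := q) (hf _ (norm_pow_lt_one hq hk))
    (differentiableAt_pow k)
  have e : logDeriv (fun x ↦ f (x ^ k)) q = logDeriv f (q ^ k) * (k * q ^ (k - 1)) := by
    simpa [Function.comp_def] using h
  rw [thetaLog, e, thetaLog]
  obtain ⟨n, rfl⟩ := Nat.exists_eq_succ_of_ne_zero hk
  rw [Nat.succ_eq_add_one, Nat.add_sub_cancel, pow_succ]
  ring

theorem thetaLog_mul {f g : ℂ → ℂ} {q : ℂ} (hf : f q ≠ 0) (hg : g q ≠ 0)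
    (df : DifferentiableAt ℂ f q) (dg : DifferentiableAt ℂ g q) :
    thetaLog (fun x ↦ f x * g x) q = thetaLog f q + thetaLog g q := by
  rw [thetaLog, logDeriv_mul q hf hg df dg, mul_add]; rfl

theorem thetaLog_div {f g : ℂ → ℂ} {q : ℂ} (hf : f q ≠ 0) (hg : g q ≠ 0)
    (df : DifferentiableAt ℂ f q) (dg : DifferentiableAt ℂ g q) :
    thetaLog (fun x ↦ f x / g x) q = thetaLog f q - thetaLog g q := by
  rw [thetaLog, logDeriv_div q hf hg df dg, mul_sub]; rfl

/-- Jacobi's formula at q and, with weight 5, at q⁵; the constants 1 + 1/4 - 5/4 cancel. -/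
theorem thetaLog_uDisc {q : ℂ} (hq0 : q ≠ 0) (hq : ‖q‖ < 1) : thetaLog uDisc q = eisen q := by
  have five : (5 : ℕ) ≠ 0 := by norm_num
  have hq5 := norm_pow_lt_one hq five
  have db := differentiableAt_phiNeg hq
  have dp := differentiableAt_psi hq
  have dB := DifferentiableAt.comp_pow (fun _ ↦ differentiableAt_phiNeg) five q hq
  have dP := DifferentiableAt.comp_pow (fun _ ↦ differentiableAt_psi) five q hq
  have nb := phiNeg_ne_zero hq
  have np := psi_ne_zero hq
  have nB := phiNeg_ne_zero hq5
  have nP := psi_ne_zero hq5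
  have e : thetaLog uDisc q = 1 + thetaLog phiNeg q + (5 : ℕ) * thetaLog psi (q ^ 5) -
      (thetaLog psi q + (5 : ℕ) * thetaLog phiNeg (q ^ 5)) := by
    rw [← logDeriv_comp_pow (fun _ ↦ differentiableAt_psi) five hq,
      ← logDeriv_comp_pow (fun _ ↦ differentiableAt_phiNeg) five hq,
      ← thetaLog_mul np nB dp dB]
    have di : DifferentiableAt ℂ (fun x : ℂ ↦ x) q := differentiableAt_fun_id
    have dm : DifferentiableAt ℂ (fun x ↦ x * phiNeg x) q := di.mul db
    have h1 : thetaLog (fun x ↦ x) q = 1 := by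
      simp [thetaLog, logDeriv_apply, hq0]
    rw [← h1, ← thetaLog_mul (f := fun x ↦ x) hq0 nb di db,
      ← thetaLog_mul (f := fun x ↦ x * phiNeg x) (mul_ne_zero hq0 nb) nP dm dP,
      ← thetaLog_div (f := fun x ↦ x * phiNeg x * psi (x ^ 5))
        (g := fun x ↦ psi x * phiNeg (x ^ 5))
        (mul_ne_zero (mul_ne_zero hq0 nb) nP) (mul_ne_zero np nB) (dm.mul dP) (dp.mul dB)]
    rfl
  have t1 := thetaLog_psi_sub_phiNeg hq
  have t2 := thetaLog_psi_sub_phiNeg hq5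
  rw [e, eisen]
  push_cast
  linear_combination -t1 / 4 + 5 / 4 * t2

theorem thetaLog_uDisc_div {q : ℂ} (hq0 : q ≠ 0) (hq : ‖q‖ < 1) :
    thetaLog (fun x ↦ uDisc x / (1 + uDisc x) ^ 2) q =
      (1 - uDisc q) / (1 + uDisc q) * eisen q := by
  have n1 := uDisc_ne_zero hq0 hq
  have n2 := one_add_uDisc_ne_zero hq
  have d1 := differentiableAt_uDisc hq
  have d2 : DifferentiableAt ℂ (fun x ↦ 1 + uDisc x) q := d1.const_add 1
  rw [thetaLog_div (g := fun x ↦ (1 + uDisc x) ^ 2) n1 (pow_ne_zero 2 n2) d1 (d2.pow 2), ← thetaLog_uDisc hq0 hq]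
  have h : thetaLog (fun x ↦ (1 + uDisc x) ^ 2) q = 2 * (q * deriv uDisc q / (1 + uDisc q)) := by
    simp only [sq]
    rw [thetaLog_mul (f := fun x ↦ 1 + uDisc x) (g := fun x ↦ 1 + uDisc x) n2 n2 d2 d2, thetaLog, logDeriv_apply, deriv_const_add]
    ring
  rw [h, mul_deriv_eq n1]
  field_simp
  ring

theorem eventually_mem_punctured_ball_of_mem {q : ℂ} (hq0 : q ≠ 0) (hq : ‖q‖ < 1) :
    ∀ᶠ x in 𝓝 q, x ≠ 0 ∧ ‖x‖ < 1 :=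
  (eventually_ne_nhds hq0).and (eventually_norm_lt_one hq)

theorem Z_ne_zero {q : ℂ} (hq0 : q ≠ 0) (hq : ‖q‖ < 1) : Z q ≠ 0 := by
  rw [Z_eq hq0 hq]
  exact mul_ne_zero (pow_ne_zero 2 (phi_ne_zero hq))
    (pow_ne_zero 2 (phi_ne_zero (norm_pow_lt_one hq (by norm_num))))

theorem z_ne_zero {q : ℂ} (hq0 : q ≠ 0) (hq : ‖q‖ < 1) : z q ≠ 0 := by
  rw [z_eq hq0]
  exact mul_ne_zero (mul_ne_zero hq0 (pow_ne_zero 2 (euler_pow_ne_zero hq two_ne_zero)))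
    (pow_ne_zero 2 (euler_pow_ne_zero hq (by norm_num)))

theorem X_eq {q : ℂ} (hq0 : q ≠ 0) (hq : ‖q‖ < 1) : X q = uDisc q / (1 + uDisc q) ^ 2 := by
  rw [X, div_eq_div_iff (Z_ne_zero hq0 hq) (pow_ne_zero 2 (one_add_uDisc_ne_zero hq)),
    ← Z_mul_uDisc hq0 hq, mul_comm]

theorem eventuallyEq_u {q : ℂ} (hq0 : q ≠ 0) (hq : ‖q‖ < 1) : u =ᶠ[𝓝 q] uDisc := by
  filter_upwards [eventually_mem_punctured_ball_of_mem hq0 hq] with x hx using u_eq hx.1 hx.2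

theorem eventuallyEq_X {q : ℂ} (hq0 : q ≠ 0) (hq : ‖q‖ < 1) :
    X =ᶠ[𝓝 q] fun x ↦ uDisc x / (1 + uDisc x) ^ 2 := by
  filter_upwards [eventually_mem_punctured_ball_of_mem hq0 hq] with x hx using X_eq hx.1 hx.2

theorem thetaLog_congr {f g : ℂ → ℂ} {q : ℂ} (h : f =ᶠ[𝓝 q] g) : thetaLog f q = thetaLog g q := by
  rw [thetaLog, thetaLog, logDeriv_apply, logDeriv_apply, h.deriv_eq, h.eq_of_nhds]

theorem thetaLog_u {q : ℂ} (hq0 : q ≠ 0) (hq : ‖q‖ < 1) : q * logDeriv u q = eisen q :=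
  (thetaLog_congr (eventuallyEq_u hq0 hq)).trans (thetaLog_uDisc hq0 hq)

theorem thetaLog_X {q : ℂ} (hq0 : q ≠ 0) (hq : ‖q‖ < 1) :
    q * logDeriv X q = (1 - uDisc q) / (1 + uDisc q) * eisen q :=
  (thetaLog_congr (eventuallyEq_X hq0 hq)).trans (thetaLog_uDisc_div hq0 hq)

/-- The branch of `√(1 - 8u - 2u² - 8u³ + u⁴)`. -/
def sqrtU (q : ℂ) : ℂ := phiNeg q * psi (q ^ 5) / (psi q * phiNeg (q ^ 5) *
  (euler (q ^ 2) ^ 2 * euler (q ^ 10) ^ 2)) * eisen q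

/-- The branch of `√((1 - 4X)(1 - 12X + 16X²))`. -/
def sqrtX (q : ℂ) : ℂ :=
  (1 - uDisc q) / (1 + uDisc q) * eisen q / (phi q ^ 2 * phi (q ^ 5) ^ 2)

/-- `sqrtU` is uE/z with the common factor q cancelled, hence regular at 0. -/
theorem z_mul_sqrtU {q : ℂ} (hq0 : q ≠ 0) (hq : ‖q‖ < 1) :
    z q * sqrtU q = uDisc q * eisen q := by
  have hq5 := norm_pow_lt_one hq (by norm_num : 5 ≠ 0)
  have n1 := psi_ne_zero hq
  have n2 := phiNeg_ne_zero hq5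
  have h2 := euler_pow_ne_zero hq two_ne_zero
  have h10 := euler_pow_ne_zero hq (by norm_num : 10 ≠ 0)
  rw [z_eq hq0, sqrtU, uDisc]
  field_simp

theorem isSqrtBranch_sqrtU :
    IsSqrtBranch (fun q ↦ 1 - 8 * u q - 2 * u q ^ 2 - 8 * u q ^ 3 + u q ^ 4) sqrtU where
  differentiableOn := by
    refine differentiableOn_ball fun q hq ↦ ?_
    have five : (5 : ℕ) ≠ 0 := by norm_num
    have ten : (10 : ℕ) ≠ 0 := by norm_num
    exact (((differentiableAt_phiNeg hq).mul
      (DifferentiableAt.comp_pow (fun _ ↦ differentiableAt_psi) five q hq)).fun_div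
      (((differentiableAt_psi hq).mul
        (DifferentiableAt.comp_pow (fun _ ↦ differentiableAt_phiNeg) five q hq)).mul
        (((differentiableAt_euler_pow hq two_ne_zero).pow 2).mul
          ((differentiableAt_euler_pow hq ten).pow 2)))
      (mul_ne_zero (mul_ne_zero (psi_ne_zero hq) (phiNeg_ne_zero (norm_pow_lt_one hq five)))
        (mul_ne_zero (pow_ne_zero 2 (euler_pow_ne_zero hq two_ne_zero))
          (pow_ne_zero 2 (euler_pow_ne_zero hq ten))))).mul (differentiableAt_eisen hq)
  map_zero := by simp [sqrtU, eisen_zero, phiNeg_zero, psi_zero, euler_zero]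
  sq_eq q hq0 hq := by
    rw [norm_pos_iff] at hq0
    have h1 := z_mul_sqrtU hq0 hq
    have h2 := eisen_sq hq0 hq
    have h3 := Z_mul_uDisc hq0 hq
    simp only [u_eq hq0 hq]
    refine mul_left_cancel₀ (pow_ne_zero 2 (z_ne_zero hq0 hq)) ?_
    -- Eliminating Z from u²E² leaves z² times (1 + u)⁴ - 12u(1 + u)² + 16u², which is the stated
    -- quartic.
    linear_combination (z q * sqrtU q + uDisc q * eisen q) * h1 + uDisc q ^ 2 * h2 +
      (Z q * uDisc q + z q * (1 + uDisc q) ^ 2 - 12 * z q * uDisc q) * h3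

theorem isSqrtBranch_sqrtX :
    IsSqrtBranch (fun q ↦ (1 - 4 * X q) * (1 - 12 * X q + 16 * X q ^ 2)) sqrtX where
  differentiableOn := by
    refine differentiableOn_ball fun q hq ↦ ?_
    have five : (5 : ℕ) ≠ 0 := by norm_num
    have d := differentiableAt_uDisc hq
    exact ((((d.const_sub 1).fun_div (d.const_add 1) (one_add_uDisc_ne_zero hq)).mul
      (differentiableAt_eisen hq))).fun_div
      (((differentiableAt_phi hq).pow 2).mul
        ((DifferentiableAt.comp_pow (fun _ ↦ differentiableAt_phi) five q hq).pow 2))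
      (mul_ne_zero (pow_ne_zero 2 (phi_ne_zero hq))
        (pow_ne_zero 2 (phi_ne_zero (norm_pow_lt_one hq five))))
  map_zero := by simp [sqrtX, eisen_zero, phi_zero, uDisc_zero]
  sq_eq q hq0 hq := by
    rw [norm_pos_iff] at hq0
    -- `h2` identifies 1 - 12X + 16X² with (E/Z)², and `h3` gives 1 - 4X = ((1 - u)/(1 + u))².
    have h2 := eisen_sq hq0 hq
    have h3 := Z_mul_uDisc hq0 hq
    have n1 := Z_ne_zero hq0 hq
    have n2 := one_add_uDisc_ne_zero hq
    simp only [X]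
    rw [sqrtX, ← Z_eq hq0 hq]
    field_simp
    rw [h2]
    linear_combination (-4 * (Z q ^ 2 - 12 * Z q * z q + 16 * z q ^ 2)) * h3

end LevelTwenty

end

theorem mainTheorem5 :
    ((∃ S : ℂ → ℂ, LevelTwenty.IsSqrtBranch (fun q => 1 - 8 * LevelTwenty.u q
          - 2 * LevelTwenty.u q ^ 2 - 8 * LevelTwenty.u q ^ 3 + LevelTwenty.u q ^ 4) S) ∧
      ∀ S : ℂ → ℂ, LevelTwenty.IsSqrtBranch (fun q => 1 - 8 * LevelTwenty.u q
          - 2 * LevelTwenty.u q ^ 2 - 8 * LevelTwenty.u q ^ 3 + LevelTwenty.u q ^ 4) S →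
        ∀ q : ℂ, 0 < ‖q‖ → ‖q‖ < 1 →
          DifferentiableAt ℂ LevelTwenty.u q ∧ LevelTwenty.u q ≠ 0 ∧
            q * logDeriv LevelTwenty.u q = LevelTwenty.z q / LevelTwenty.u q * S q) ∧
    ((∃ W : ℂ → ℂ, LevelTwenty.IsSqrtBranch (fun q => (1 - 4 * LevelTwenty.X q)
          * (1 - 12 * LevelTwenty.X q + 16 * LevelTwenty.X q ^ 2)) W) ∧
      ∀ W : ℂ → ℂ, LevelTwenty.IsSqrtBranch (fun q => (1 - 4 * LevelTwenty.X q)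
          * (1 - 12 * LevelTwenty.X q + 16 * LevelTwenty.X q ^ 2)) W →
        ∀ q : ℂ, 0 < ‖q‖ → ‖q‖ < 1 →
          DifferentiableAt ℂ LevelTwenty.X q ∧ LevelTwenty.X q ≠ 0 ∧
            q * logDeriv LevelTwenty.X q = LevelTwenty.Z q * W q) := by
  refine ⟨⟨⟨_, LevelTwenty.isSqrtBranch_sqrtU⟩, fun S hS q hq0 hq ↦ ?_⟩,
    ⟨⟨_, LevelTwenty.isSqrtBranch_sqrtX⟩, fun W hW q hq0 hq ↦ ?_⟩⟩
  · rw [norm_pos_iff] at hq0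
    have hu := LevelTwenty.uDisc_ne_zero hq0 hq
    refine ⟨(LevelTwenty.differentiableAt_uDisc hq).congr_of_eventuallyEq
      (LevelTwenty.eventuallyEq_u hq0 hq), ?_, ?_⟩
    · rwa [LevelTwenty.u_eq hq0 hq]
    · rw [LevelTwenty.thetaLog_u hq0 hq, hS.unique LevelTwenty.isSqrtBranch_sqrtU hq,
        LevelTwenty.u_eq hq0 hq, div_mul_eq_mul_div, LevelTwenty.z_mul_sqrtU hq0 hq,
        mul_div_cancel_left₀ _ hu]
  · rw [norm_pos_iff] at hq0
    have hZ := LevelTwenty.Z_ne_zero hq0 hq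
    have hu := LevelTwenty.differentiableAt_uDisc hq
    refine ⟨DifferentiableAt.congr_of_eventuallyEq ?_ (LevelTwenty.eventuallyEq_X hq0 hq),
      div_ne_zero (LevelTwenty.z_ne_zero hq0 hq) hZ, ?_⟩
    · exact hu.fun_div ((hu.const_add 1).pow 2)
        (pow_ne_zero 2 (LevelTwenty.one_add_uDisc_ne_zero hq))
    · rw [LevelTwenty.thetaLog_X hq0 hq, hW.unique LevelTwenty.isSqrtBranch_sqrtX hq,
        LevelTwenty.sqrtX, ← LevelTwenty.Z_eq hq0 hq, mul_div_cancel₀ _ hZ]
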